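/- Let $n\ge 0$ be an integer and let $B(z,\omega)$ be a holomorphic function on $\mathbb{C}^*\times\mathbb{C}$. Let $X\to\mathbb{P}^1$ be the rational Laufer curve with geometric potential $B$, that is, the complex threefold obtained by gluing two copies of $\mathbb{C}\times\mathbb{C}^2$, with coordinates $(z,\omega_1,\omega_2)$ and $(z',\omega_1',\omega_2')$, along $z\neq 0$, $z'\ne 0$ by $$z'=1/z,\qquad \omega_1'=z^{-n}\,\omega_1,\qquad \omega_2'=z^{n+2}\bigl(\omega_2+\partial_\omega B(z,\omega_1)\bigr).$$ Define the superpotential $W:\mathbb{C}^{n+1}\to\mathbb{C}$ by $$W(x_0,\dots,x_n)=\frac{1}{2\pi \mathrm{i}}\oint_{|z|=1} B\Bigl(z,\sum_{i=0}^n x_i z^i\Bigr)\,dz .$$ Let $x=(x_0,\dots,x_n)$ be a critical point of $W$, i.e. $\partial W/\partial x_i(x)=0$ for $i=0,\dots,n$, and let $r$ be the corank, i.e. $n+1$ minus the rank, of the Hessian matrix of $W$ at $x$. Then there is exactly one holomorphic section $\Sigma$ of $X\to\mathbb{P}^1$ whose first fibre coordinate over the chart with coordinate $z$ is $\omega_1(z)=\sum_{i=0}^n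 x_i z^i$, and the normal bundle of the curve $\Sigma\cong\mathbb{P}^1$ in $X$ is isomorphic to $\mathcal{O}(-r-1)\oplus\mathcal{O}(r-1)$. -/

import Mathlib

/-! Complex geometry over the projective line, in the standard atlas: `U₀` with coordinate `z`,
`U₁` with coordinate `z'`, and `z' = 1 / z` on the overlap. -/

namespace Laufer

/-- A holomorphic vector bundle on `ℙ¹` with fibre `ι → ℂ`, given by its transition matrix in the
standard atlas: a vector with coordinates `v` over `U₀` at `z ≠ 0` has coordinates
`v' = trans z *ᵥ v` over `U₁` at `z' = 1 / z`. -/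
structure P1Bundle (ι : Type) [Fintype ι] [DecidableEq ι] where
  trans : ℂ → Matrix ι ι ℂ
  holo : ∀ i j, DifferentiableOn ℂ (fun z => trans z i j) {z | z ≠ 0}
  inv : ∀ z, z ≠ 0 → IsUnit (trans z).det

namespace P1Bundle

variable {ι κ μ : Type} [Fintype ι] [DecidableEq ι] [Fintype κ] [DecidableEq κ]
  [Fintype μ] [DecidableEq μ]

/-- The line bundle `𝒪(k)`: the fibre coordinates are related by `v' = z ^ (-k) v`. -/
noncomputable def lineO (k : ℤ) : P1Bundle Unit where
  trans z := Matrix.of fun _ _ => z ^ (-k)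
  holo _ _ := fun z hz => (differentiableAt_zpow.2 (Or.inl hz)).differentiableWithinAt
  inv z hz := by
    rw [Matrix.det_unique]
    exact (zpow_ne_zero _ hz).isUnit

/-- The holomorphic tangent bundle of `ℙ¹`. -/
noncomputable def tangentP1 : P1Bundle Unit where
  trans z := Matrix.of fun _ _ => deriv (fun w : ℂ => w⁻¹) z
  holo _ _ := by
    intro z hz
    simp only [Matrix.of_apply, deriv_inv]
    exact (((differentiableAt_id.pow 2).inv (pow_ne_zero 2 hz)).neg).differentiableWithinAt
  inv z hz := by
    rw [Matrix.det_unique]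
    simp [hz]

/-- The direct sum of two vector bundles. -/
def directSum (E : P1Bundle ι) (F : P1Bundle κ) : P1Bundle (ι ⊕ κ) where
  trans z := Matrix.fromBlocks (E.trans z) 0 0 (F.trans z)
  holo i j := by
    rcases i with i | i <;> rcases j with j | j
    · exact E.holo i j
    · exact differentiableOn_const (c := (0 : ℂ))
    · exact differentiableOn_const (c := (0 : ℂ))
    · exact F.holo i j
  inv z hz := by
    rw [Matrix.det_fromBlocks_zero₂₁]
    exact (E.inv z hz).mul (F.inv z hz)

/-- A homomorphism of holomorphic vector bundles: holomorphic matrices over each of the two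
charts, compatible with the transition matrices on the overlap. -/
structure Hom (E : P1Bundle ι) (F : P1Bundle κ) where
  map₀ : ℂ → Matrix κ ι ℂ
  map₁ : ℂ → Matrix κ ι ℂ
  holo₀ : ∀ i j, Differentiable ℂ (fun z => map₀ z i j)
  holo₁ : ∀ i j, Differentiable ℂ (fun z => map₁ z i j)
  compat : ∀ z, z ≠ 0 → map₁ z⁻¹ * E.trans z = F.trans z * map₀ z

/-- `0 → E → F → G → 0` is exact on the fibre over every point of `ℙ¹`. -/
def ShortExact {E : P1Bundle ι} {F : P1Bundle κ} {G : P1Bundle μ}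
    (f : Hom E F) (g : Hom F G) : Prop :=
  (∀ z, Function.Injective (f.map₀ z).mulVec ∧
    Function.Exact (f.map₀ z).mulVec (g.map₀ z).mulVec ∧
    Function.Surjective (g.map₀ z).mulVec) ∧
  (∀ z, Function.Injective (f.map₁ z).mulVec ∧
    Function.Exact (f.map₁ z).mulVec (g.map₁ z).mulVec ∧
    Function.Surjective (g.map₁ z).mulVec)

end P1Bundle

/-- A complex threefold fibred over `ℙ¹` with fibre `ℂ²`: two copies of `ℂ × ℂ²`, with coordinates
`(z, ω₁, ω₂)` and `(z', ω₁', ω₂')`, are glued along `z ≠ 0` and `z' ≠ 0` by a biholomorphic map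
`glue` that covers `z' = 1 / z`. -/
structure Fibration where
  glue : (Fin 3 → ℂ) → (Fin 3 → ℂ)
  glueInv : (Fin 3 → ℂ) → (Fin 3 → ℂ)
  base : ∀ p, p 0 ≠ 0 → glue p 0 = (p 0)⁻¹
  baseInv : ∀ p, p 0 ≠ 0 → glueInv p 0 = (p 0)⁻¹
  left_inv : ∀ p, p 0 ≠ 0 → glueInv (glue p) = p
  right_inv : ∀ p, p 0 ≠ 0 → glue (glueInv p) = p
  holo : AnalyticOnNhd ℂ glue {p | p 0 ≠ 0}
  holoInv : AnalyticOnNhd ℂ glueInv {p | p 0 ≠ 0}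

namespace Fibration

/-- A holomorphic section of the fibration, written in the two charts. -/
structure Section (X : Fibration) where
  chart₀ : ℂ → Fin 3 → ℂ
  chart₁ : ℂ → Fin 3 → ℂ
  holo₀ : Differentiable ℂ chart₀
  holo₁ : Differentiable ℂ chart₁
  base₀ : ∀ z, chart₀ z 0 = z
  base₁ : ∀ z, chart₁ z 0 = z
  compat : ∀ z, z ≠ 0 → chart₁ z⁻¹ = X.glue (chart₀ z)

variable {X : Fibration}

theorem isOpen_overlap : IsOpen {p : Fin 3 → ℂ | p 0 ≠ 0} :=
  isOpen_ne_fun (continuous_apply 0) continuous_const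

/-- The restriction to a section of the holomorphic tangent bundle of the threefold: its transition
matrix is the Jacobian matrix of the gluing map. -/
noncomputable def Section.tangentAlong (s : X.Section) : P1Bundle (Fin 3) where
  trans z := LinearMap.toMatrix' (fderiv ℂ X.glue (s.chart₀ z) : (Fin 3 → ℂ) →ₗ[ℂ] (Fin 3 → ℂ))
  holo i j := by
    intro z hz
    have h0 : s.chart₀ z 0 ≠ 0 := by rw [s.base₀]; exact hz
    have h1 : DifferentiableAt ℂ (fun w => fderiv ℂ X.glue (s.chart₀ w)) z :=
      ((X.holo.fderiv _ h0).differentiableAt).comp z (s.holo₀ z)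
    have h2 : DifferentiableAt ℂ (fun w => fderiv ℂ X.glue (s.chart₀ w) (Pi.single j 1)) z :=
      h1.clm_apply (differentiableAt_const _)
    have h3 := (differentiableAt_pi.1 h2) i
    simpa [LinearMap.toMatrix'_apply] using h3.differentiableWithinAt
  inv z hz := by
    have h0 : s.chart₀ z 0 ≠ 0 := by rw [s.base₀]; exact hz
    set p := s.chart₀ z
    have hg : X.glue p 0 ≠ 0 := by rw [X.base p h0]; exact inv_ne_zero h0
    have h1 := ((X.holoInv _ hg).differentiableAt).hasFDerivAt
    have h2 := ((X.holo _ h0).differentiableAt).hasFDerivAt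
    have h3 := h1.comp p h2
    have h4 : HasFDerivAt (X.glueInv ∘ X.glue) (ContinuousLinearMap.id ℂ (Fin 3 → ℂ)) p := by
      refine (hasFDerivAt_id p).congr_of_eventuallyEq ?_
      filter_upwards [isOpen_overlap.mem_nhds h0] with q hq using X.left_inv q hq
    have h5 := h3.unique h4
    have h6 : LinearMap.toMatrix' (fderiv ℂ X.glueInv (X.glue p) :
          (Fin 3 → ℂ) →ₗ[ℂ] (Fin 3 → ℂ)) *
        LinearMap.toMatrix' (fderiv ℂ X.glue p : (Fin 3 → ℂ) →ₗ[ℂ] (Fin 3 → ℂ)) = 1 := by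
      rw [← LinearMap.toMatrix'_comp, ← LinearMap.toMatrix'_id]
      congr 1
      ext1 v
      exact congrArg (fun L : (Fin 3 → ℂ) →L[ℂ] (Fin 3 → ℂ) => L (Pi.single v 1)) h5 |> fun h => by
        ext k; simpa using congrFun h k
    have h7 := congrArg Matrix.det h6
    rw [Matrix.det_mul, Matrix.det_one] at h7
    exact IsUnit.of_mul_eq_one_right _ h7

/-- The differential of a section, from the tangent bundle of `ℙ¹` to the restricted tangent bundle
of the threefold. Its image is the tangent bundle of the curve that the section embeds. -/
noncomputable def Section.differential (s : X.Section) :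
    P1Bundle.Hom P1Bundle.tangentP1 s.tangentAlong where
  map₀ z := Matrix.of fun i _ => deriv s.chart₀ z i
  map₁ z := Matrix.of fun i _ => deriv s.chart₁ z i
  holo₀ i _ := differentiable_pi.1 (s.holo₀.deriv) i
  holo₁ i _ := differentiable_pi.1 (s.holo₁.deriv) i
  compat z hz := by
    have h0 : s.chart₀ z 0 ≠ 0 := by rw [s.base₀]; exact hz
    have h1 : HasDerivAt (fun w => s.chart₁ w⁻¹)
        (deriv (fun w : ℂ => w⁻¹) z • deriv s.chart₁ z⁻¹) z :=
      HasDerivAt.scomp z (s.holo₁ z⁻¹).hasDerivAt (differentiableAt_inv hz).hasDerivAt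
    have h2 : HasDerivAt (fun w => X.glue (s.chart₀ w))
        (fderiv ℂ X.glue (s.chart₀ z) (deriv s.chart₀ z)) z :=
      ((X.holo _ h0).differentiableAt.hasFDerivAt).comp_hasDerivAt z (s.holo₀ z).hasDerivAt
    have h3 : (fun w => s.chart₁ w⁻¹) =ᶠ[nhds z] fun w => X.glue (s.chart₀ w) := by
      filter_upwards [isOpen_ne.mem_nhds hz] with w hw using s.compat w hw
    have h4 := (h2.congr_of_eventuallyEq h3).unique h1
    ext i u
    have h5 := LinearMap.toMatrix'_mulVec
      (fderiv ℂ X.glue (s.chart₀ z) : (Fin 3 → ℂ) →ₗ[ℂ] (Fin 3 → ℂ)) (deriv s.chart₀ z)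
    have h6 := congrFun (h5.trans h4) i
    rw [Matrix.mul_apply, Fintype.sum_unique]
    exact (mul_comm _ _).trans h6.symm

/-- `N` is (isomorphic to) the normal bundle of the section: it is the quotient of the restricted
tangent bundle of the threefold by the tangent bundle of the curve. -/
def Section.IsNormalBundle {ι : Type} [Fintype ι] [DecidableEq ι] (s : X.Section)
    (N : P1Bundle ι) : Prop :=
  ∃ q : P1Bundle.Hom s.tangentAlong N, P1Bundle.ShortExact s.differential q

end Fibration

/-- `B(z, ω)` is holomorphic on `ℂ* × ℂ`. -/
def IsPotential (B : ℂ → ℂ → ℂ) : Prop :=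
  AnalyticOnNhd ℂ (fun p : ℂ × ℂ => B p.1 p.2) {p | p.1 ≠ 0}

theorem IsPotential.partial {B : ℂ → ℂ → ℂ} (hB : IsPotential B) :
    AnalyticOnNhd ℂ (fun p : ℂ × ℂ => deriv (B p.1) p.2) {p | p.1 ≠ 0} := by
  have hopen : IsOpen {p : ℂ × ℂ | p.1 ≠ 0} := isOpen_ne_fun continuous_fst continuous_const
  have h1 : AnalyticOnNhd ℂ
      (fun p : ℂ × ℂ => fderiv ℂ (fun p : ℂ × ℂ => B p.1 p.2) p (0, 1)) {p | p.1 ≠ 0} :=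
    fun p hp => ((ContinuousLinearMap.apply ℂ ℂ ((0 : ℂ), (1 : ℂ))).analyticAt _).comp (hB.fderiv p hp)
  refine h1.congr hopen ?_
  intro p hp
  have h2 := (hB p hp).differentiableAt.hasFDerivAt
  have h3 : HasDerivAt (fun w : ℂ => (p.1, w)) ((0 : ℂ), (1 : ℂ)) p.2 :=
    (hasDerivAt_const _ _).prodMk (hasDerivAt_id _)
  exact (HasFDerivAt.comp_hasDerivAt p.2 h2 h3).deriv.symm

theorem analyticAt_coord (i : Fin 3) (p : Fin 3 → ℂ) :
    AnalyticAt ℂ (fun q : Fin 3 → ℂ => q i) p :=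
  (ContinuousLinearMap.proj (R := ℂ) (φ := fun _ : Fin 3 => ℂ) i).analyticAt p

/-- The rational Laufer curve with geometric potential `B`:
`z' = 1 / z`, `ω₁' = z ^ (-n) ω₁`, `ω₂' = z ^ (n + 2) (ω₂ + ∂_ω B (z, ω₁))`. -/
noncomputable def laufer (n : ℕ) (B : ℂ → ℂ → ℂ) (hB : IsPotential B) : Fibration where
  glue p := ![(p 0)⁻¹, (p 0) ^ (-(n : ℤ)) * p 1, (p 0) ^ (n + 2) * (p 2 + deriv (B (p 0)) (p 1))]
  glueInv p := ![(p 0)⁻¹, (p 0) ^ (-(n : ℤ)) * p 1,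
    (p 0) ^ (n + 2) * p 2 - deriv (B (p 0)⁻¹) ((p 0) ^ (-(n : ℤ)) * p 1)]
  base _ _ := rfl
  baseInv _ _ := rfl
  left_inv p hp := by
    ext i
    fin_cases i
    · simp
    · simp [hp]
    · simp [hp]
  right_inv p hp := by
    ext i
    fin_cases i
    · simp
    · simp [hp]
    · simp [hp]
  holo p hp := by
    have hp' : p 0 ≠ 0 := hp
    rw [analyticAt_pi_iff]
    intro i
    fin_cases i
    · exact (analyticAt_coord 0 p).inv hp'
    · exact ((analyticAt_coord 0 p).zpow hp').mul (analyticAt_coord 1 p)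
    · exact ((analyticAt_coord 0 p).pow (n + 2)).mul ((analyticAt_coord 2 p).add
        (AnalyticAt.fun_comp (g := fun p : ℂ × ℂ => deriv (B p.1) p.2)
          (f := fun q : Fin 3 → ℂ => (q 0, q 1)) (hB.partial (p 0, p 1) hp')
          ((analyticAt_coord 0 p).prod (analyticAt_coord 1 p))))
  holoInv p hp := by
    have hp' : p 0 ≠ 0 := hp
    have h0 := (analyticAt_coord 0 p).inv hp'
    have h1 := ((analyticAt_coord 0 p).zpow (n := -(n : ℤ)) hp').mul (analyticAt_coord 1 p)
    rw [analyticAt_pi_iff]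
    intro i
    fin_cases i
    · exact h0
    · exact h1
    · exact (((analyticAt_coord 0 p).pow (n + 2)).mul (analyticAt_coord 2 p)).sub
        (AnalyticAt.fun_comp (g := fun p : ℂ × ℂ => deriv (B p.1) p.2)
          (f := fun q : Fin 3 → ℂ => ((q 0)⁻¹, (q 0) ^ (-(n : ℤ)) * q 1))
          (hB.partial ((p 0)⁻¹, (p 0) ^ (-(n : ℤ)) * p 1) (inv_ne_zero hp')) (h0.prod h1))

/-- The superpotential `W(x) = (1 / 2πi) ∮ B(z, ∑ xᵢ zⁱ) dz`, over the unit circle. -/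
noncomputable def superpotential (n : ℕ) (B : ℂ → ℂ → ℂ) (x : Fin (n + 1) → ℂ) : ℂ :=
  (2 * Real.pi * Complex.I)⁻¹ * ∮ z in C(0, 1), B z (∑ i, x i * z ^ (i : ℕ))

/-- The partial derivative of `f` in the `i`-th variable. -/
noncomputable def pderiv {n : ℕ} (i : Fin (n + 1)) (f : (Fin (n + 1) → ℂ) → ℂ) :
    (Fin (n + 1) → ℂ) → ℂ :=
  fun x => fderiv ℂ f x (Pi.single i 1)

/-- The Hessian matrix of `f`. -/
noncomputable def hessian {n : ℕ} (f : (Fin (n + 1) → ℂ) → ℂ) (x : Fin (n + 1) → ℂ) :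
    Matrix (Fin (n + 1)) (Fin (n + 1)) ℂ :=
  fun i j => pderiv i (pderiv j f) x

/-- The corank `n + 1 - rank` of a square matrix of size `n + 1`. -/
noncomputable def corank {n : ℕ} (H : Matrix (Fin (n + 1)) (Fin (n + 1)) ℂ) : ℕ :=
  n + 1 - H.rank

end Laufer

/-! Everything is read off from Laurent coefficients along ω₁(z) = ∑ xᵢ zⁱ. Differentiation under
the integral gives ∂W/∂xⱼ as the coefficient of z^(-j-1) in ∂_ω B(z, ω₁(z)). At a critical point the
coefficients in degrees -1, …, -(n+1) vanish, so this function splits into an entire function of z,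
which is -ω₂, and z^(-n-2) times an entire function of 1/z, which is ω₂' (`exists_section`). Two
choices of ω₂ differ by a global section of 𝒪(-n-2), which is zero (`section_unique`).

The normal bundle is the vertical block of the Jacobian of the gluing
(`isNormalBundle_of_vertical`). It is an extension of 𝒪(n) by 𝒪(-n-2), with cocycle h(z) = ∂²_ω B(z,
ω₁(z)). Only the coefficients c₀, …, c₂ₙ of h in degrees -1, …, -(2n+1) affect the extension class,
and the Hessian of W is the Hankel matrix c_(i+j) (`hessian_superpotential_apply`).

To split the extension, write the relevant principal part of h as q / z^(2n+1), with q a polynomial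
of degree at most 2n, and run the extended Euclidean algorithm on X^(2n+1) and q
(`exists_euclid_stage`). Stopped midway, it yields two rows of cofactors with constant determinant,
whose degrees are balanced about n and n+1 up to an excess e (`PadePair`). These rows are the change
of frame to 𝒪(-e-1) ⊕ 𝒪(e-1) (`exists_vertical_splitting`). The same rows describe the kernel of the
Hankel matrix: it consists of the multiples α a of the shorter cofactor a with deg α < e. Hence e is
the corank (`corank_hankel`). -/

namespace Laufer

open Metric Filter Topology

/-! ### Laurent splitting on the punctured plane -/

/-- The Cauchy integral of `h` over the circle of radius `R` about the origin. -/
noncomputable def cauchyTransform (h : ℂ → ℂ) (R : ℝ) (z : ℂ) : ℂ :=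
  (2 * Real.pi * Complex.I : ℂ)⁻¹ • ∮ w in C(0, R), (w - z)⁻¹ • h w

theorem ne_zero_of_mem_sphere {R : ℝ} (hR : 0 < R) {w : ℂ} (hw : w ∈ sphere (0 : ℂ) R) :
    w ≠ 0 := by
  rintro rfl
  simp at hw
  exact hR.ne hw

theorem continuousOn_sphere {h : ℂ → ℂ} (hh : DifferentiableOn ℂ h {z | z ≠ 0}) {R : ℝ}
    (hR : 0 < R) : ContinuousOn h (sphere 0 R) :=
  hh.continuousOn.mono fun _ hw => ne_zero_of_mem_sphere hR hw

theorem differentiableOn_cauchyTransform {h : ℂ → ℂ} (hh : DifferentiableOn ℂ h {z | z ≠ 0})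
    {R : ℝ} (hR : 0 < R) : DifferentiableOn ℂ (cauchyTransform h R) (ball 0 R) := by
  lift R to NNReal using hR.le
  have h1 := hasFPowerSeriesOn_cauchy_integral
    ((continuousOn_sphere hh hR).circleIntegrable hR.le) (NNReal.coe_pos.1 hR)
  have h2 := h1.differentiableOn
  rwa [Metric.eball_coe] at h2

theorem circleIntegral_eq_of_radii {f : ℂ → ℂ} {ε R : ℝ} (hε : 0 < ε) (hle : ε ≤ R)
    (hf : ∀ w, ε ≤ ‖w‖ → DifferentiableAt ℂ f w) :
    (∮ w in C(0, R), f w) = ∮ w in C(0, ε), f w := by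
  refine Complex.circleIntegral_eq_of_differentiable_on_annulus_off_countable hε hle
    Set.countable_empty (fun w hw => ?_) fun w hw => hf w ?_
  · refine (hf w ?_).continuousAt.continuousWithinAt
    simpa using hw.2
  · have := hw.1.2
    simp only [mem_closedBall, dist_zero_right, not_le] at this
    exact this.le

theorem differentiableAt_of_ne_zero {h : ℂ → ℂ} (hh : DifferentiableOn ℂ h {z | z ≠ 0}) {w : ℂ}
    (hw : w ≠ 0) : DifferentiableAt ℂ h w :=
  hh.differentiableAt (isOpen_ne.mem_nhds hw)

theorem cauchyTransform_eq_of_radii {h : ℂ → ℂ} (hh : DifferentiableOn ℂ h {z | z ≠ 0})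
    {z : ℂ} {ε R : ℝ} (hz : ‖z‖ < ε) (hle : ε ≤ R) :
    cauchyTransform h R z = cauchyTransform h ε z := by
  have hε : 0 < ε := (norm_nonneg z).trans_lt hz
  unfold cauchyTransform
  congr 1
  refine circleIntegral_eq_of_radii hε hle fun w hw => ?_
  have hwz : w - z ≠ 0 := by
    rw [sub_ne_zero]
    rintro rfl
    exact absurd hz (not_lt.2 hw)
  have hw0 : w ≠ 0 := norm_pos_iff.1 (hε.trans_le hw)
  exact ((differentiableAt_id.sub_const z).inv hwz).smul (differentiableAt_of_ne_zero hh hw0)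

/-- Cauchy's formula on an annulus. -/
theorem eq_cauchyTransform_sub {h : ℂ → ℂ} (hh : DifferentiableOn ℂ h {z | z ≠ 0})
    {z : ℂ} {ε R : ℝ} (hε : 0 < ε) (hεz : ε < ‖z‖) (hzR : ‖z‖ < R) :
    h z = cauchyTransform h R z - cauchyTransform h ε z := by
  have hz : z ≠ 0 := norm_pos_iff.1 (hε.trans hεz)
  -- The divided difference of h at z has no pole at z, so its integrals over the two circles agree.
  -- Expanding both gives the formula.
  have hg : DifferentiableOn ℂ (dslope h z) {w | w ≠ 0} :=
    (Complex.differentiableOn_dslope (isOpen_ne.mem_nhds hz)).2 hh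
  have h1 : (∮ w in C(0, R), dslope h z w) = ∮ w in C(0, ε), dslope h z w :=
    circleIntegral_eq_of_radii hε (hεz.trans hzR).le fun w hw =>
      differentiableAt_of_ne_zero hg (norm_pos_iff.1 (hε.trans_le hw))
  have h2 : ∀ ρ : ℝ, 0 < ρ → ρ ≠ ‖z‖ → (∮ w in C(0, ρ), dslope h z w) =
      (∮ w in C(0, ρ), (w - z)⁻¹ • h w) - h z * ∮ w in C(0, ρ), (w - z)⁻¹ := by
    intro ρ hρ hne
    have hwz : ∀ w ∈ sphere (0 : ℂ) ρ, w ≠ z := by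
      rintro w hw rfl
      simp at hw
      exact hne hw.symm
    have hc : ContinuousOn (fun w : ℂ => (w - z)⁻¹) (sphere 0 ρ) :=
      (continuousOn_id.sub continuousOn_const).inv₀ fun w hw => sub_ne_zero.2 (hwz w hw)
    have hi1 : CircleIntegrable (fun w => (w - z)⁻¹ • h w) 0 ρ :=
      (hc.smul (continuousOn_sphere hh hρ)).circleIntegrable hρ.le
    have hi2 : CircleIntegrable (fun w => h z * (w - z)⁻¹) 0 ρ :=
      (continuousOn_const.mul hc).circleIntegrable hρ.le
    rw [← circleIntegral.integral_const_mul, ← circleIntegral.integral_sub hi1 hi2]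
    refine circleIntegral.integral_congr hρ.le fun w hw => ?_
    rw [dslope_of_ne _ (hwz w hw), slope_def_field, smul_eq_mul]
    ring
  rw [h2 R (hε.trans (hεz.trans hzR)) hzR.ne', h2 ε hε hεz.ne,
    circleIntegral.integral_sub_inv_of_mem_ball (by simpa using hzR)] at h1
  have h3 : (∮ w in C(0, ε), (w - z)⁻¹) = 0 := by
    refine Complex.circleIntegral_eq_zero_of_differentiable_on_off_countable hε.le
      Set.countable_empty (fun w hw => ?_) fun w hw => ?_
    · refine ContinuousAt.continuousWithinAt ?_
      refine (continuousAt_id.sub continuousAt_const).inv₀ (sub_ne_zero.2 ?_)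
      rintro rfl
      simp at hw
      exact absurd hεz (not_lt.2 hw)
    · refine (differentiableAt_id.sub_const z).inv (sub_ne_zero.2 ?_)
      rintro rfl
      have := hw.1
      simp at this
      exact lt_asymm hεz this
  rw [h3, mul_zero, sub_zero] at h1
  unfold cauchyTransform
  rw [← h1, ← smul_sub, sub_sub_cancel, smul_eq_mul]
  have : (2 * Real.pi * Complex.I : ℂ) ≠ 0 := Complex.two_pi_I_ne_zero
  field_simp

/-- A holomorphic function on the punctured plane is the sum of an entire function of `z` and an
entire function of `z⁻¹` that vanishes at `0`. -/
theorem exists_laurent_splitting {h : ℂ → ℂ} (hh : DifferentiableOn ℂ h {z | z ≠ 0}) :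
    ∃ p k : ℂ → ℂ, Differentiable ℂ p ∧ Differentiable ℂ k ∧ k 0 = 0 ∧
      ∀ z, z ≠ 0 → h z = p z + k z⁻¹ := by
  set p : ℂ → ℂ := fun z => cauchyTransform h (‖z‖ + 1) z
  have hp_eq : ∀ (z : ℂ) (R : ℝ), ‖z‖ < R → cauchyTransform h R z = p z := by
    intro z R hz
    rcases le_total (‖z‖ + 1) R with h1 | h1
    · exact cauchyTransform_eq_of_radii hh (by linarith) h1
    · exact (cauchyTransform_eq_of_radii hh hz h1).symm
  have hp : Differentiable ℂ p := by
    intro z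
    have hR : 0 < ‖z‖ + 1 := by positivity
    have hz : ball (0 : ℂ) (‖z‖ + 1) ∈ 𝓝 z := isOpen_ball.mem_nhds (by simp)
    refine ((differentiableOn_cauchyTransform hh hR).differentiableAt hz).congr_of_eventuallyEq ?_
    filter_upwards [hz] with w hw
    exact (hp_eq w _ (by simpa using hw)).symm
  -- The value 0 at the origin is the limit of h - p at infinity, which makes the singularity
  -- removable.
  set k : ℂ → ℂ := fun u => if u = 0 then 0 else h u⁻¹ - p u⁻¹ with hk_def
  have hk0 : k 0 = 0 := by simp [hk_def]
  have hk_ne : ∀ u, u ≠ 0 → k u = h u⁻¹ - p u⁻¹ := fun u hu => by simp [hk_def, hu]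
  obtain ⟨M, hM⟩ := (isCompact_sphere (0 : ℂ) 1).exists_bound_of_continuousOn
    (continuousOn_sphere hh one_pos)
  have hbound : ∀ z : ℂ, 2 < ‖z‖ → ‖cauchyTransform h 1 z‖ ≤ (‖z‖ - 1)⁻¹ * M := by
    intro z hz
    have := circleIntegral.norm_two_pi_i_inv_smul_integral_le_of_norm_le_const
      (f := fun w => (w - z)⁻¹ • h w) (c := 0) (R := 1) (C := (‖z‖ - 1)⁻¹ * M) zero_le_one ?_
    · rw [one_mul] at this
      exact this
    · intro w hw
      rw [norm_smul, norm_inv]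
      have h1 : ‖w‖ = 1 := by simpa using hw
      have h2 : ‖z‖ - 1 ≤ ‖w - z‖ := by
        rw [norm_sub_rev, ← h1]
        exact norm_sub_norm_le z w
      have h3 : 0 ≤ ‖h w‖ := norm_nonneg _
      have h4 : (0 : ℝ) < ‖z‖ - 1 := by linarith
      have h5 := hM w hw
      gcongr
  have hk_small : ∀ u, u ≠ 0 → ‖u‖ < 1 / 2 → ‖k u‖ ≤ 2 * ‖u‖ * M := by
    intro u hu hu'
    have hn : 0 < ‖u‖ := norm_pos_iff.2 hu
    have hz : 2 < ‖u⁻¹‖ := by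
      rw [norm_inv, lt_inv_comm₀ two_pos hn]
      linarith
    -- Outside the unit circle the annulus formula identifies h - p with minus the Cauchy integral
    -- over that circle, which decays like the inverse of the distance to the origin.
    have h1 : k u = -cauchyTransform h 1 u⁻¹ := by
      rw [hk_ne u hu, eq_cauchyTransform_sub hh one_pos (by linarith) (lt_add_one ‖u⁻¹‖)]
      simp only [p]
      ring
    rw [h1, norm_neg]
    refine (hbound _ hz).trans ?_
    have hM0 : 0 ≤ M := (norm_nonneg _).trans (hM 1 (by simp))
    refine mul_le_mul_of_nonneg_right ?_ hM0
    rw [inv_le_comm₀ (by linarith) (by positivity), norm_inv, mul_inv]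
    rw [norm_inv] at hz
    linarith
  have hk : Differentiable ℂ k := by
    rw [← differentiableOn_univ, ← Complex.differentiableOn_compl_singleton_and_continuousAt_iff
      (c := 0) Filter.univ_mem]
    constructor
    · intro u hu
      have hu0 : u ≠ 0 := by simpa using hu
      have h1 : DifferentiableAt ℂ (fun u => h u⁻¹ - p u⁻¹) u :=
        ((differentiableAt_of_ne_zero hh (inv_ne_zero hu0)).comp u (differentiableAt_inv hu0)).sub
          ((hp _).comp u (differentiableAt_inv hu0))
      refine (h1.congr_of_eventuallyEq ?_).differentiableWithinAt
      filter_upwards [isOpen_ne.mem_nhds hu0] with w hw using hk_ne w hw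
    · rw [ContinuousAt, hk0]
      refine squeeze_zero_norm' (a := fun u => 2 * ‖u‖ * M) ?_ ?_
      · filter_upwards [ball_mem_nhds (0 : ℂ) (by norm_num : (0 : ℝ) < 1 / 2)] with u hu
        rcases eq_or_ne u 0 with rfl | h0
        · simp [hk0]
        · exact hk_small u h0 (by simpa using hu)
      · have : Continuous fun u : ℂ => 2 * ‖u‖ * M := by fun_prop
        simpa using this.tendsto 0
  refine ⟨p, k, hp, hk, hk0, fun z hz => ?_⟩
  rw [hk_ne _ (inv_ne_zero hz), inv_inv]
  ring

/-! ### Taylor and Laurent expansions with explicit coefficients -/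

theorem differentiable_dslope {k : ℂ → ℂ} (hk : Differentiable ℂ k) (c : ℂ) :
    Differentiable ℂ (dslope k c) := by
  rw [← differentiableOn_univ] at hk ⊢
  exact (Complex.differentiableOn_dslope Filter.univ_mem).2 hk

theorem eq_add_mul_dslope (k : ℂ → ℂ) (u : ℂ) : k u = k 0 + u * dslope k 0 u := by
  have := sub_smul_dslope k 0 u
  rw [sub_zero, smul_eq_mul] at this
  rw [this]
  ring

/-- Taylor expansion at the origin of an entire function vanishing there. -/
theorem exists_taylor_expansion {k : ℂ → ℂ} (hk : Differentiable ℂ k) (hk0 : k 0 = 0) (m : ℕ) :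
    ∃ (c : ℕ → ℂ) (K : ℂ → ℂ), Differentiable ℂ K ∧
      ∀ u, k u = ∑ j ∈ Finset.range m, c j * u ^ (j + 1) + u ^ (m + 1) * K u := by
  induction m with
  | zero =>
    refine ⟨0, dslope k 0, differentiable_dslope hk 0, fun u => ?_⟩
    rw [eq_add_mul_dslope k u, hk0]
    simp
  | succ m ih =>
    obtain ⟨c, K, hK, h⟩ := ih
    refine ⟨Function.update c m (K 0), dslope K 0, differentiable_dslope hK 0, fun u => ?_⟩
    rw [h u, eq_add_mul_dslope K u, Finset.sum_range_succ, Function.update_self]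
    have h1 : ∑ j ∈ Finset.range m, Function.update c m (K 0) j * u ^ (j + 1) =
        ∑ j ∈ Finset.range m, c j * u ^ (j + 1) := Finset.sum_congr rfl fun j hj => by
      rw [Function.update_of_ne (Finset.mem_range.1 hj).ne]
    rw [h1]
    ring

/-- The integral of `z ^ (-2) L(z⁻¹)` over the unit circle vanishes for `L` entire. -/
theorem circleIntegral_inv_sq_mul_comp_inv {L : ℂ → ℂ} (hL : Differentiable ℂ L) :
    (∮ z in C(0, 1), z⁻¹ ^ 2 * L z⁻¹) = 0 := by
  -- If P is a primitive of L, then -P(1/z) is a primitive of the integrand.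
  obtain ⟨P, hP⟩ := hL.isExactOn_univ
  refine circleIntegral.integral_eq_zero_of_hasDerivWithinAt (f := fun z => -P z⁻¹) zero_le_one
    fun z hz => ?_
  have hz0 := ne_zero_of_mem_sphere one_pos hz
  have h1 := ((hP z⁻¹ trivial).comp z (hasDerivAt_inv hz0)).neg.hasDerivWithinAt (s := sphere 0 1)
  refine h1.congr_deriv ?_
  rw [inv_pow]
  ring

theorem two_pi_I_inv_mul_circleIntegral_inv :
    (2 * Real.pi * Complex.I : ℂ)⁻¹ * (∮ z in C(0, 1), z⁻¹) = 1 := by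
  have := circleIntegral.integral_sub_inv_of_mem_ball (c := 0) (w := 0) (R := 1) (by simp)
  simp only [sub_zero] at this
  rw [this, inv_mul_cancel₀ Complex.two_pi_I_ne_zero]

/-- A holomorphic function on the punctured plane, with its Laurent coefficients in degrees
`-1, …, -m` singled out. -/
theorem exists_laurent_expansion {h : ℂ → ℂ} (hh : DifferentiableOn ℂ h {z | z ≠ 0}) (m : ℕ) :
    ∃ p K : ℂ → ℂ, Differentiable ℂ p ∧ Differentiable ℂ K ∧ ∀ z, z ≠ 0 →
      h z = p z + ∑ j ∈ Finset.range m,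
        ((2 * Real.pi * Complex.I)⁻¹ * ∮ w in C(0, 1), w ^ j * h w) * z⁻¹ ^ (j + 1) +
        z⁻¹ ^ (m + 1) * K z⁻¹ := by
  obtain ⟨p, k, hp, hk, hk0, hsplit⟩ := exists_laurent_splitting hh
  obtain ⟨c, K, hK, htaylor⟩ := exists_taylor_expansion hk hk0 m
  refine ⟨p, K, hp, hK, fun z hz => ?_⟩
  rw [hsplit z hz, htaylor, ← add_assoc]
  congr 2
  refine Finset.sum_congr rfl fun j hj => ?_
  have hjm : j < m := Finset.mem_range.1 hj
  congr 1
  have hinv : ContinuousOn (fun w : ℂ => w⁻¹) (sphere 0 1) :=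
    continuousOn_id.inv₀ fun w hw => ne_zero_of_mem_sphere one_pos hw
  have hterm : ∀ i : ℕ, ContinuousOn (fun w : ℂ => c i * (w ^ j * w⁻¹ ^ (i + 1))) (sphere 0 1) :=
    fun i => continuousOn_const.mul ((continuousOn_id.pow j).mul (hinv.pow (i + 1)))
  have hlast : Differentiable ℂ fun u : ℂ => u ^ (m - 1 - j) * K u := by fun_prop
  have hfirst : Differentiable ℂ fun w : ℂ => w ^ j * p w := by fun_prop
  -- After multiplication by w^j the tail still carries a factor w^(-2), because j < m. So the
  -- entire part and the tail both integrate to zero, and in the finite sum only the term i = j has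
  -- a residue.
  have h1 : (∮ w in C(0, 1), w ^ j * h w) =
      ∮ w in C(0, 1), ((w ^ j * p w + ∑ i ∈ Finset.range m, c i * (w ^ j * w⁻¹ ^ (i + 1))) +
        w⁻¹ ^ 2 * (w⁻¹ ^ (m - 1 - j) * K w⁻¹)) := by
    refine circleIntegral.integral_congr zero_le_one fun w hw => ?_
    have hw0 := ne_zero_of_mem_sphere one_pos hw
    rw [hsplit w hw0, htaylor, mul_add, mul_add, Finset.mul_sum, ← add_assoc]
    congr 1
    · congr 1
      exact Finset.sum_congr rfl fun i _ => by ring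
    · have h2 : w⁻¹ ^ (m + 1) = w⁻¹ ^ j * (w⁻¹ ^ 2 * w⁻¹ ^ (m - 1 - j)) := by
        rw [← pow_add, ← pow_add]
        congr 1
        omega
      rw [h2]
      have h3 : w ^ j * w⁻¹ ^ j = 1 := by rw [← mul_pow, mul_inv_cancel₀ hw0, one_pow]
      linear_combination (w⁻¹ ^ 2 * w⁻¹ ^ (m - 1 - j) * K w⁻¹) * h3
  rw [h1, circleIntegral.integral_add, circleIntegral.integral_add,
    circleIntegral_inv_sq_mul_comp_inv hlast,
    hfirst.diffContOnCl.circleIntegral_eq_zero zero_le_one,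
    circleIntegral.integral_fun_sum fun i _ => (hterm i).circleIntegrable zero_le_one,
    zero_add, add_zero, Finset.sum_eq_single j]
  · have h2 : (∮ w in C(0, 1), c j * (w ^ j * w⁻¹ ^ (j + 1))) = c j * ∮ w in C(0, 1), w⁻¹ := by
      rw [← circleIntegral.integral_const_mul]
      refine circleIntegral.integral_congr zero_le_one fun w hw => ?_
      have hw0 := ne_zero_of_mem_sphere one_pos hw
      rw [pow_succ, ← mul_assoc (w ^ j), ← mul_pow, mul_inv_cancel₀ hw0, one_pow, one_mul]
    rw [h2, mul_left_comm, two_pi_I_inv_mul_circleIntegral_inv, mul_one]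
  · intro i _ hij
    have h2 : (∮ w in C(0, 1), c i * (w ^ j * w⁻¹ ^ (i + 1))) =
        c i * ∮ w in C(0, 1), (w - 0) ^ ((j : ℤ) - i - 1) := by
      rw [← circleIntegral.integral_const_mul]
      refine circleIntegral.integral_congr zero_le_one fun w hw => ?_
      have hw0 := ne_zero_of_mem_sphere one_pos hw
      rw [sub_zero, inv_pow, ← zpow_natCast, ← zpow_natCast, ← zpow_neg, ← zpow_add₀ hw0]
      congr 2
      push_cast
      ring
    rw [h2, circleIntegral.integral_sub_zpow_of_ne (by omega), mul_zero]
  · exact fun hn => absurd hj hn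
  · exact hfirst.continuous.continuousOn.circleIntegrable zero_le_one
  · exact (continuousOn_finsetSum _ fun i _ => hterm i).circleIntegrable zero_le_one
  · exact (hfirst.continuous.continuousOn.add
      (continuousOn_finsetSum _ fun i _ => hterm i)).circleIntegrable zero_le_one
  · exact ((hinv.pow 2).mul
      ((hlast.continuous.comp_continuousOn hinv))).circleIntegrable zero_le_one

end Laufer

namespace Laufer

open Metric Filter Topology

/-! ### Derivatives of the superpotential -/

theorem IsPotential.differentiableAt {B : ℂ → ℂ → ℂ} (hB : IsPotential B) {z : ℂ} (hz : z ≠ 0)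
    (w : ℂ) : DifferentiableAt ℂ (B z) w := by
  have h1 : DifferentiableAt ℂ (fun v : ℂ => (z, v)) w := by fun_prop
  exact DifferentiableAt.comp (g := fun p : ℂ × ℂ => B p.1 p.2) w (hB (z, w) hz).differentiableAt h1

theorem IsPotential.continuous_comp {B : ℂ → ℂ → ℂ} (hB : IsPotential B) {X : Type*}
    [TopologicalSpace X] {f g : X → ℂ} (hf : Continuous f) (hg : Continuous g)
    (h0 : ∀ t, f t ≠ 0) : Continuous fun t => B (f t) (g t) :=
  hB.continuousOn.comp_continuous (hf.prodMk hg) h0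

theorem IsPotential.differentiableOn_comp {B : ℂ → ℂ → ℂ} (hB : IsPotential B) {g : ℂ → ℂ}
    (hg : Differentiable ℂ g) : DifferentiableOn ℂ (fun z => B z (g z)) {z | z ≠ 0} := by
  intro z hz
  exact (DifferentiableAt.comp (g := fun p : ℂ × ℂ => B p.1 p.2) z
    (hB (z, g z) hz).differentiableAt
    (differentiableAt_id.prodMk (hg z))).differentiableWithinAt

theorem IsPotential.pow_mul_deriv {B : ℂ → ℂ → ℂ} (hB : IsPotential B) (i : ℕ) :
    IsPotential fun z w => z ^ i * deriv (B z) w :=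
  fun p hp => (analyticAt_fst.pow i).mul (hB.partial p hp)

/-- Evaluation at `z` of the polynomial with coefficients `x`, as a linear form in `x`. -/
noncomputable def evalCLM (n : ℕ) (z : ℂ) : (Fin (n + 1) → ℂ) →L[ℂ] ℂ :=
  ∑ i : Fin (n + 1), z ^ (i : ℕ) • ContinuousLinearMap.proj (R := ℂ) (φ := fun _ => ℂ) i

theorem evalCLM_apply (n : ℕ) (z : ℂ) (x : Fin (n + 1) → ℂ) :
    evalCLM n z x = ∑ i, x i * z ^ (i : ℕ) := by
  simp [evalCLM, mul_comm]

theorem evalCLM_single (n : ℕ) (z : ℂ) (i : Fin (n + 1)) :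
    evalCLM n z (Pi.single i 1) = z ^ (i : ℕ) := by
  rw [evalCLM_apply, Finset.sum_eq_single i]
  · simp
  · intro j _ hj
    simp [hj]
  · simp

theorem continuous_evalCLM (n : ℕ) : Continuous (evalCLM n) := by
  unfold evalCLM
  fun_prop

/-- Differentiation under the integral sign. The derivative is again a superpotential, of the
potential zⁱ ∂_ω B, so the same lemma applied twice computes the Hessian. -/
theorem pderiv_superpotential {n : ℕ} {B : ℂ → ℂ → ℂ} (hB : IsPotential B) (i : Fin (n + 1)) :
    pderiv i (superpotential n B) =
      superpotential n fun z w => z ^ (i : ℕ) * deriv (B z) w := by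
  funext x
  have hc : Continuous (circleMap 0 1) := continuous_circleMap 0 1
  have hd : Continuous (deriv (circleMap 0 1)) := by
    simp only [funext (deriv_circleMap 0 1)]
    fun_prop
  have hne : ∀ θ, circleMap 0 1 θ ≠ 0 := fun θ => circleMap_ne_center one_ne_zero
  have hev : Continuous fun p : (Fin (n + 1) → ℂ) × ℝ => evalCLM n (circleMap 0 1 p.2) p.1 :=
    ((continuous_evalCLM n).comp (hc.comp continuous_snd)).clm_apply continuous_fst
  set F : (Fin (n + 1) → ℂ) → ℝ → ℂ := fun y θ =>
    deriv (circleMap 0 1) θ • B (circleMap 0 1 θ) (evalCLM n (circleMap 0 1 θ) y) with hF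
  set F' : (Fin (n + 1) → ℂ) → ℝ → (Fin (n + 1) → ℂ) →L[ℂ] ℂ := fun y θ =>
    (deriv (circleMap 0 1) θ *
      deriv (B (circleMap 0 1 θ)) (evalCLM n (circleMap 0 1 θ) y)) • evalCLM n (circleMap 0 1 θ)
    with hF'
  have hFc : Continuous fun p : (Fin (n + 1) → ℂ) × ℝ => F p.1 p.2 :=
    (hd.comp continuous_snd).smul
      (hB.continuous_comp (hc.comp continuous_snd) hev fun p => hne p.2)
  have hF'c : Continuous fun p : (Fin (n + 1) → ℂ) × ℝ => F' p.1 p.2 :=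
    ((hd.comp continuous_snd).mul
      (hB.partial.continuousOn.comp_continuous ((hc.comp continuous_snd).prodMk hev)
        fun p => hne p.2)).smul ((continuous_evalCLM n).comp (hc.comp continuous_snd))
  have hFy : ∀ y, Continuous (F y) := fun y => hFc.comp (continuous_const.prodMk continuous_id)
  have hF'y : ∀ y, Continuous (F' y) := fun y => hF'c.comp (continuous_const.prodMk continuous_id)
  -- Joint continuity on a compact set supplies the constant dominating function.
  obtain ⟨C, hC⟩ := ((isCompact_closedBall x 1).prod
    (isCompact_Icc (a := (0 : ℝ)) (b := 2 * Real.pi))).exists_bound_of_continuousOn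
      hF'c.continuousOn
  have hderiv : HasFDerivAt (fun y => ∫ θ in (0 : ℝ)..2 * Real.pi, F y θ)
      (∫ θ in (0 : ℝ)..2 * Real.pi, F' x θ) x := by
    refine intervalIntegral.hasFDerivAt_integral_of_dominated_of_fderiv_le (bound := fun _ => C)
      (closedBall_mem_nhds x one_pos)
      (Eventually.of_forall fun y => (hFy y).aestronglyMeasurable)
      ((hFy x).intervalIntegrable _ _) (hF'y x).aestronglyMeasurable
      (Eventually.of_forall fun θ hθ y hy => ?_) intervalIntegrable_const
      (Eventually.of_forall fun θ _ y _ => ?_)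
    · rw [Set.uIoc_of_le Real.two_pi_pos.le] at hθ
      exact hC (y, θ) ⟨hy, hθ.1.le, hθ.2⟩
    · have h1 := ((hB.differentiableAt (hne θ)
        (evalCLM n (circleMap 0 1 θ) y)).hasDerivAt.comp_hasFDerivAt y
          (evalCLM n (circleMap 0 1 θ)).hasFDerivAt).const_smul (deriv (circleMap 0 1) θ)
      rw [smul_smul] at h1
      exact h1
  have hW : superpotential n B =
      (2 * Real.pi * Complex.I : ℂ)⁻¹ • fun y => ∫ θ in (0 : ℝ)..2 * Real.pi, F y θ := by
    funext y
    simp only [Pi.smul_apply, superpotential, circleIntegral, hF, evalCLM_apply, smul_eq_mul]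
  unfold pderiv
  rw [hW, (hderiv.const_smul _).fderiv, smul_apply,
    ContinuousLinearMap.intervalIntegral_apply ((hF'y x).intervalIntegrable _ _)]
  simp only [superpotential, circleIntegral, hF', smul_eq_mul, smul_apply,
    evalCLM_single]
  simp only [evalCLM_apply]
  congr 2
  funext θ
  ring

theorem pderiv_superpotential_apply {n : ℕ} {B : ℂ → ℂ → ℂ} (hB : IsPotential B)
    (i : Fin (n + 1)) (x : Fin (n + 1) → ℂ) :
    pderiv i (superpotential n B) x = (2 * Real.pi * Complex.I)⁻¹ *
      ∮ z in C(0, 1), z ^ (i : ℕ) * deriv (B z) (∑ k, x k * z ^ (k : ℕ)) := by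
  rw [pderiv_superpotential hB]
  rfl

theorem hessian_superpotential_apply {n : ℕ} {B : ℂ → ℂ → ℂ} (hB : IsPotential B)
    (x : Fin (n + 1) → ℂ) (i j : Fin (n + 1)) :
    hessian (superpotential n B) x i j = (2 * Real.pi * Complex.I)⁻¹ *
      ∮ z in C(0, 1), z ^ ((i : ℕ) + j) * deriv (deriv (B z)) (∑ k, x k * z ^ (k : ℕ)) := by
  unfold hessian
  rw [pderiv_superpotential hB, pderiv_superpotential_apply (hB.pow_mul_deriv _)]
  simp only [deriv_const_mul_field]
  simp only [pow_add, mul_assoc]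

theorem IsPotential.deriv_snd {B : ℂ → ℂ → ℂ} (hB : IsPotential B) :
    IsPotential fun z w => deriv (B z) w :=
  hB.partial

/-! ### The section through a critical point -/

theorem differentiable_fin3 {f g h : ℂ → ℂ} (hf : Differentiable ℂ f) (hg : Differentiable ℂ g)
    (hh : Differentiable ℂ h) : Differentiable ℂ fun z => ![f z, g z, h z] := by
  rw [differentiable_pi]
  intro i
  fin_cases i
  · exact hf
  · exact hg
  · exact hh

theorem zpow_neg_mul_sum {n : ℕ} (x : Fin (n + 1) → ℂ) {z : ℂ} (hz : z ≠ 0) :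
    z ^ (-(n : ℤ)) * ∑ i, x i * z ^ (i : ℕ) = ∑ i, x i * z⁻¹ ^ (n - (i : ℕ)) := by
  rw [Finset.mul_sum]
  refine Finset.sum_congr rfl fun i _ => ?_
  rw [inv_pow, ← zpow_natCast, ← zpow_natCast, ← zpow_neg, mul_left_comm, ← zpow_add₀ hz,
    Nat.cast_sub (Nat.lt_succ_iff.1 i.2)]
  congr 2
  ring

/-- The critical equations are exactly the vanishing of the Laurent coefficients of ∂_ω B(z, ω₁(z))
that can be absorbed neither into ω₂ nor, after multiplication by z^(n+2), into ω₂'. -/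
theorem exists_section {n : ℕ} {B : ℂ → ℂ → ℂ} (hB : IsPotential B) (x : Fin (n + 1) → ℂ)
    (hx : ∀ i, pderiv i (superpotential n B) x = 0) :
    ∃ s : (laufer n B hB).Section, ∀ z, s.chart₀ z 1 = ∑ i, x i * z ^ (i : ℕ) := by
  have hω : Differentiable ℂ fun z : ℂ => ∑ i, x i * z ^ (i : ℕ) := by fun_prop
  obtain ⟨p, K, hp, hK, h⟩ := exists_laurent_expansion (hB.deriv_snd.differentiableOn_comp hω)
    (n + 1)
  have h' : ∀ z, z ≠ 0 → deriv (B z) (∑ i, x i * z ^ (i : ℕ)) = p z + z⁻¹ ^ (n + 2) * K z⁻¹ := by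
    intro z hz
    rw [h z hz, Finset.sum_eq_zero, add_zero]
    intro j hj
    have := hx ⟨j, Finset.mem_range.1 hj⟩
    rw [pderiv_superpotential_apply hB] at this
    rw [this, zero_mul]
  refine ⟨{ chart₀ := fun z => ![z, ∑ i, x i * z ^ (i : ℕ), -p z]
            chart₁ := fun u => ![u, ∑ i, x i * u ^ (n - (i : ℕ)), K u]
            holo₀ := differentiable_fin3 differentiable_id hω hp.neg
            holo₁ := differentiable_fin3 differentiable_id (by fun_prop) hK
            base₀ := fun _ => rfl
            base₁ := fun _ => rfl
            compat := fun z hz => ?_ }, fun _ => rfl⟩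
  ext i
  fin_cases i
  · rfl
  · exact (zpow_neg_mul_sum x hz).symm
  · change K z⁻¹ = z ^ (n + 2) * (-p z + deriv (B z) (∑ i, x i * z ^ (i : ℕ)))
    rw [h' z hz, neg_add_cancel_left, ← mul_assoc, ← mul_pow, mul_inv_cancel₀ hz, one_pow, one_mul]

/-- A continuous function is determined by its values away from the origin. -/
theorem eq_of_forall_ne_zero {E : Type*} [TopologicalSpace E] [T2Space E] {f g : ℂ → E}
    (hf : Continuous f) (hg : Continuous g) (h : ∀ u, u ≠ 0 → f u = g u) : f = g :=
  hf.ext_on (dense_compl_singleton (0 : ℂ)) hg fun u hu => h u hu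

/-- An entire function `δ` with `z ^ (m + 1) δ(z)` holomorphic at infinity vanishes. -/
theorem eq_zero_of_pow_mul_eq {δ ε : ℂ → ℂ} (hδ : Differentiable ℂ δ) (hε : Differentiable ℂ ε)
    (m : ℕ) (h : ∀ z, z ≠ 0 → ε z⁻¹ = z ^ (m + 1) * δ z) : δ = 0 := by
  funext w
  refine hδ.apply_eq_of_tendsto_cocompact w ?_
  -- With u = 1/z, δ(z) = u^(m+1) ε(u) tends to 0 as z tends to infinity, so Liouville's theorem
  -- applies.
  have h1 : Tendsto (fun z : ℂ => z⁻¹) (cocompact ℂ) (𝓝 0) := by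
    rw [← Metric.cobounded_eq_cocompact]
    exact tendsto_inv₀_cobounded
  have h2 : Continuous fun u : ℂ => u ^ (m + 1) * ε u :=
    (continuous_id.pow _).mul hε.continuous
  have h3 := (h2.tendsto 0).comp h1
  rw [zero_pow (Nat.succ_ne_zero m), zero_mul] at h3
  refine h3.congr' ?_
  filter_upwards [(isCompact_singleton (x := (0 : ℂ))).compl_mem_cocompact] with z hz
  have hz0 : z ≠ 0 := hz
  rw [Function.comp_apply, h z hz0, ← mul_assoc, ← mul_pow, inv_mul_cancel₀ hz0, one_pow, one_mul]

/-- With ω₁ fixed, the terms in B cancel in the difference of the two gluing equations for ω₂. What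
remains is a global section of 𝒪(-n-2). -/
theorem section_unique {n : ℕ} {B : ℂ → ℂ → ℂ} {hB : IsPotential B}
    (s t : (laufer n B hB).Section) (hst : ∀ z, t.chart₀ z 1 = s.chart₀ z 1) : t = s := by
  have h2 : (fun z => t.chart₀ z 2 - s.chart₀ z 2) = 0 := by
    refine eq_zero_of_pow_mul_eq (ε := fun u => t.chart₁ u 2 - s.chart₁ u 2) (m := n + 1)
      ((differentiable_pi.1 t.holo₀ 2).sub (differentiable_pi.1 s.holo₀ 2))
      ((differentiable_pi.1 t.holo₁ 2).sub (differentiable_pi.1 s.holo₁ 2)) fun z hz => ?_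
    rw [t.compat z hz, s.compat z hz]
    change (t.chart₀ z 0) ^ (n + 2) *
        (t.chart₀ z 2 + deriv (B (t.chart₀ z 0)) (t.chart₀ z 1)) -
      (s.chart₀ z 0) ^ (n + 2) *
        (s.chart₀ z 2 + deriv (B (s.chart₀ z 0)) (s.chart₀ z 1)) = _
    rw [t.base₀, s.base₀, hst]
    ring
  have h0 : t.chart₀ = s.chart₀ := by
    funext z i
    fin_cases i
    · exact (t.base₀ z).trans (s.base₀ z).symm
    · exact hst z
    · exact sub_eq_zero.1 (congrFun h2 z)
  have h1 : t.chart₁ = s.chart₁ := by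
    refine eq_of_forall_ne_zero t.holo₁.continuous s.holo₁.continuous fun u hu => ?_
    have ht := t.compat u⁻¹ (inv_ne_zero hu)
    have hs := s.compat u⁻¹ (inv_ne_zero hu)
    rw [inv_inv] at ht hs
    rw [ht, hs, h0]
  cases s
  cases t
  simp_all

end Laufer

namespace Laufer

open Polynomial

/-! ### Unimodular Padé pairs -/

/-- `p` has degree at most `m`; for negative `m` this means `p = 0`. -/
def DegLE (p : ℂ[X]) (m : ℤ) : Prop :=
  p ≠ 0 → (p.natDegree : ℤ) ≤ m

theorem DegLE.mul {p q : ℂ[X]} {k l : ℤ} (hp : DegLE p k) (hq : DegLE q l) :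
    DegLE (p * q) (k + l) := by
  intro h
  have hp0 := left_ne_zero_of_mul h
  have hq0 := right_ne_zero_of_mul h
  rw [natDegree_mul hp0 hq0, Nat.cast_add]
  exact add_le_add (hp hp0) (hq hq0)

theorem DegLE.mono {p : ℂ[X]} {k l : ℤ} (hp : DegLE p k) (h : k ≤ l) : DegLE p l :=
  fun h0 => (hp h0).trans h

theorem DegLE.sub {p q : ℂ[X]} {k : ℤ} (hp : DegLE p k) (hq : DegLE q k) : DegLE (p - q) k := by
  intro h
  by_cases hp0 : p = 0
  · subst hp0
    rw [zero_sub, natDegree_neg]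
    exact hq (by simpa using h)
  by_cases hq0 : q = 0
  · subst hq0
    rw [sub_zero]
    exact hp hp0
  have h1 := natDegree_sub_le p q
  have h2 := hp hp0
  have h3 := hq hq0
  omega

theorem DegLE.eq_zero {p : ℂ[X]} {k : ℤ} (hp : DegLE p k) (hk : k < 0) : p = 0 := by
  by_contra h
  have := hp h
  omega

theorem DegLE.of_X_pow_mul {p : ℂ[X]} {k : ℤ} {N : ℕ} (hp : DegLE (X ^ N * p) k) :
    DegLE p (k - N) := by
  intro h
  have := hp (mul_ne_zero (pow_ne_zero _ X_ne_zero) h)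
  rw [natDegree_mul (pow_ne_zero _ X_ne_zero) h, natDegree_X_pow] at this
  push_cast at this
  omega

theorem degLE_iff_degree_lt {p : ℂ[X]} {m : ℕ} : DegLE p (m - 1) ↔ p.degree < m := by
  by_cases h : p = 0
  · subst h
    simp [DegLE]
  · rw [degree_eq_natDegree h, Nat.cast_lt]
    simp only [DegLE, ne_eq, h, not_false_eq_true, true_implies]
    omega

/-- The extended Euclidean algorithm applied to `M` and `q` with `deg q < deg M`, stopped when the
degrees of the cofactors overtake those of the remainders. -/
theorem exists_euclid_stage (M q : ℂ[X]) : ∀ (d : ℕ) (a b a' b' : ℂ[X]),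
    (b' * M + a' * q).degree < d →
    (∃ c : ℂ, c ≠ 0 ∧ a * b' - a' * b = C c) →
    a' ≠ 0 → b * M + a * q ≠ 0 →
    (b * M + a * q).natDegree + a'.natDegree = M.natDegree →
    (b' * M + a' * q).degree < (b * M + a * q).degree → a.degree < a'.degree →
    a.degree ≤ (b * M + a * q).degree + 1 →
    ∃ a b a' b' : ℂ[X], (∃ c : ℂ, c ≠ 0 ∧ a * b' - a' * b = C c) ∧
      a' ≠ 0 ∧ b * M + a * q ≠ 0 ∧
      (b * M + a * q).natDegree + a'.natDegree = M.natDegree ∧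
      a.degree ≤ (b * M + a * q).degree + 1 ∧ (b' * M + a' * q).degree < a'.degree := by
  intro d
  induction d with
  | zero =>
    intro a b a' b' hd hc ha' hR hdeg _ _ haR
    have h0 : b' * M + a' * q = 0 := by
      rw [← degree_eq_bot, ← Nat.WithBot.lt_zero_iff]
      exact_mod_cast hd
    refine ⟨a, b, a', b', hc, ha', hR, hdeg, haR, ?_⟩
    rw [h0, degree_zero]
    exact bot_lt_iff_ne_bot.2 (degree_ne_bot.2 ha')
  | succ d ih =>
    intro a b a' b' hd hc ha' hR hdeg hRR haa haR
    by_cases hlarge : (b' * M + a' * q).degree < a'.degree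
    · exact ⟨a, b, a', b', hc, ha', hR, hdeg, haR, hlarge⟩
    rw [not_lt] at hlarge
    set R := b * M + a * q with hR_def
    set R' := b' * M + a' * q with hR'_def
    have hR' : R' ≠ 0 := by
      rintro h
      rw [h, degree_zero, le_bot_iff, degree_eq_bot] at hlarge
      exact ha' hlarge
    have hmod : (b - R / R' * b') * M + (a - R / R' * a') * q = R % R' := by
      rw [EuclideanDomain.mod_eq_sub_mul_div, hR_def, hR'_def]
      ring
    have hlt : (R % R').degree < R'.degree := degree_mod_lt R hR'
    have hQ : R / R' ≠ 0 := by
      intro h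
      have h1 := degree_add_div hR' hRR.le
      rw [h, degree_zero, WithBot.add_bot] at h1
      exact hR (degree_eq_bot.1 h1.symm)
    have hQdeg : R'.natDegree + (R / R').natDegree = R.natDegree := by
      have h1 := degree_add_div hR' hRR.le
      rw [degree_eq_natDegree hR', degree_eq_natDegree hQ, degree_eq_natDegree hR] at h1
      exact_mod_cast h1
    have hRnat : R'.natDegree < R.natDegree := natDegree_lt_natDegree hR' hRR
    -- The leading term of the new cofactor comes from the quotient times a', so the cofactor gains
    -- exactly the degree that the remainder loses. This preserves the sum of degrees.
    have hQa : a.degree < (R / R' * a').degree := by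
      refine haa.trans_le ?_
      rw [degree_mul]
      exact le_add_of_nonneg_left (zero_le_degree_iff.2 hQ)
    have hnew : (a - R / R' * a').degree = (R / R' * a').degree :=
      degree_sub_eq_right_of_degree_lt hQa
    have hnew0 : a - R / R' * a' ≠ 0 := by
      intro h
      rw [h, degree_zero] at hnew
      exact (mul_ne_zero hQ ha') (degree_eq_bot.1 hnew.symm)
    have haa' : a'.degree < (a - R / R' * a').degree := by
      rw [hnew, degree_mul, degree_eq_natDegree ha', degree_eq_natDegree hQ]
      norm_cast
      omega
    -- One Euclidean step: the determinant changes sign, and the failed stopping test deg a' ≤ deg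
    -- R' is what bounds the new first cofactor by its remainder.
    refine ih a' b' (a - R / R' * a') (b - R / R' * b') ?_ ?_ hnew0 hR' ?_ ?_ haa' ?_
    · rw [hmod]
      refine hlt.trans_le ?_
      rw [degree_eq_natDegree hR'] at hd ⊢
      exact_mod_cast Nat.lt_succ_iff.1 (by exact_mod_cast hd)
    · obtain ⟨c, hc0, hc⟩ := hc
      refine ⟨-c, neg_ne_zero.2 hc0, ?_⟩
      rw [C_neg, ← hc]
      ring
    · rw [natDegree_eq_of_degree_eq hnew, natDegree_mul hQ ha', ← hR'_def]
      omega
    · rwa [hmod]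
    · refine hlarge.trans ?_
      exact le_add_of_nonneg_right zero_le_one

/-- A basis of the lattice of pairs `(a, b)`, with remainders `b X ^ (2n + 1) + a q`, adapted to the
degrees at infinity. -/
structure PadePair (n : ℕ) (q : ℂ[X]) (e : ℕ) where
  (a b a' b' : ℂ[X])
  c : ℂ
  c_ne : c ≠ 0
  det : a * b' - a' * b = C c
  deg_a : DegLE a (n + 1 - e)
  deg_R : DegLE (b * X ^ (2 * n + 1) + a * q) (n - e)
  deg_a' : DegLE a' (n + 1 + e)
  deg_R' : DegLE (b' * X ^ (2 * n + 1) + a' * q) (n + e)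

/-- At the stopping stage deg R + deg a' = 2n + 1, so deg a' = n + 1 ± e forces deg R = n ∓ e. The
remaining two bounds follow from the stopping inequalities. The sign decides which row is the
shorter one. -/
theorem exists_padePair (n : ℕ) (q : ℂ[X]) (hq : q.natDegree ≤ 2 * n) :
    ∃ e, Nonempty (PadePair n q e) := by
  have hqd : q.degree < ((2 * n + 1 : ℕ) : WithBot ℕ) :=
    degree_le_natDegree.trans_lt (by exact_mod_cast Nat.lt_succ_iff.2 hq)
  obtain ⟨a, b, a', b', ⟨c, hc0, hc⟩, ha', hR, hdeg, haR, hRa⟩ :=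
    -- The starting rows (0, 1) and (1, 0) have remainders X^(2n+1) and q.
    exists_euclid_stage (X ^ (2 * n + 1)) q (2 * n + 1) 0 1 1 0 (by simpa using hqd)
      ⟨-1, by simp, by simp⟩ one_ne_zero (by simp) (by simp) (by simpa using hqd)
      (by simp) (by simp)
  rw [natDegree_X_pow] at hdeg
  set R := b * X ^ (2 * n + 1) + a * q with hR_def
  set R' := b' * X ^ (2 * n + 1) + a' * q with hR'_def
  have h1 : DegLE a (R.natDegree + 1) := by
    intro h
    rw [degree_eq_natDegree h, degree_eq_natDegree hR] at haR
    exact_mod_cast haR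
  have h2 : DegLE R R.natDegree := fun _ => le_rfl
  have h3 : DegLE a' a'.natDegree := fun _ => le_rfl
  have h4 : DegLE R' (a'.natDegree - 1) := by
    rw [degLE_iff_degree_lt, ← degree_eq_natDegree ha']
    exact hRa
  rcases le_or_gt (n + 1) a'.natDegree with hn | hn
  · refine ⟨a'.natDegree - (n + 1), ⟨⟨a, b, a', b', c, hc0, hc, h1.mono ?_, h2.mono ?_, h3.mono ?_,
      h4.mono ?_⟩⟩⟩ <;> omega
  · refine ⟨n + 1 - a'.natDegree, ⟨⟨a', b', a, b, -c, neg_ne_zero.2 hc0, ?_, h3.mono ?_, h4.mono ?_,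
      h1.mono ?_, h2.mono ?_⟩⟩⟩
    · rw [C_neg, ← hc]
      ring
    all_goals omega

/-! ### The kernel of a Hankel matrix -/

/-- The polynomial `∑ c_k X ^ (2n - k)`, over `k ≤ 2n`. -/
noncomputable def hankelPoly (n : ℕ) (c : ℕ → ℂ) : ℂ[X] :=
  ∑ k ∈ Finset.range (2 * n + 1), monomial (2 * n - k) (c k)

theorem coeff_hankelPoly (n : ℕ) (c : ℕ → ℂ) (l : ℕ) :
    (hankelPoly n c).coeff l = if l ≤ 2 * n then c (2 * n - l) else 0 := by
  unfold hankelPoly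
  rw [finsetSum_coeff]
  simp only [coeff_monomial]
  split_ifs with h
  · rw [Finset.sum_eq_single (2 * n - l)]
    · rw [if_pos (by omega)]
    · intro k hk hne
      rw [Finset.mem_range] at hk
      rw [if_neg (by omega)]
    · intro hn
      simp at hn
  · refine Finset.sum_eq_zero fun k _ => if_neg (by omega)

theorem natDegree_hankelPoly_le (n : ℕ) (c : ℕ → ℂ) : (hankelPoly n c).natDegree ≤ 2 * n := by
  rw [natDegree_le_iff_coeff_eq_zero]
  intro l hl
  rw [coeff_hankelPoly, if_neg (by omega)]

/-- The square Hankel matrix `c_(i + j)` of size `n + 1`. -/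
def hankel (n : ℕ) (c : ℕ → ℂ) : Matrix (Fin (n + 1)) (Fin (n + 1)) ℂ :=
  fun i j => c (i + j)

/-- Reversing the coefficients turns the Hankel product into a convolution. Since 2n - i ≥ n ≥ deg
p, the convolution sum involves every coefficient of p. -/
theorem hankel_mulVec_apply (n : ℕ) (c : ℕ → ℂ) {p : ℂ[X]} (hp : p.natDegree ≤ n)
    (i : Fin (n + 1)) :
    (hankel n c).mulVec (fun j => p.coeff j) i = (p * hankelPoly n c).coeff (2 * n - i) := by
  rw [coeff_mul, Finset.Nat.sum_antidiagonal_eq_sum_range_succ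
    (fun k l => p.coeff k * (hankelPoly n c).coeff l)]
  have hi : (i : ℕ) ≤ n := Nat.lt_succ_iff.1 i.2
  have h1 : ∑ k ∈ Finset.range (2 * n - i).succ,
      p.coeff k * (hankelPoly n c).coeff (2 * n - i - k) =
      ∑ k ∈ Finset.range (n + 1), p.coeff k * (hankelPoly n c).coeff (2 * n - i - k) := by
    symm
    refine Finset.sum_subset (fun k hk => ?_) fun k _ hk => ?_
    · rw [Finset.mem_range] at hk ⊢
      omega
    · rw [Finset.mem_range, not_lt] at hk
      rw [coeff_eq_zero_of_natDegree_lt (by omega), zero_mul]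
  rw [h1, ← Fin.sum_univ_eq_sum_range
    (fun k : ℕ => p.coeff k * (hankelPoly n c).coeff (2 * n - i - k))]
  rw [Matrix.mulVec, dotProduct]
  refine Finset.sum_congr rfl fun j _ => ?_
  have hj : (j : ℕ) ≤ n := Nat.lt_succ_iff.1 j.2
  rw [coeff_hankelPoly, if_pos (by omega), mul_comm]
  unfold hankel
  congr 2
  omega

/-- A polynomial of degree at most `n` gives a kernel vector of the Hankel matrix if and only if
its product with `hankelPoly` has a small remainder modulo `X ^ (2n + 1)`. -/
theorem hankel_mulVec_eq_zero_iff (n : ℕ) (c : ℕ → ℂ) {p : ℂ[X]} (hp : p.natDegree ≤ n) :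
    (hankel n c).mulVec (fun j => p.coeff j) = 0 ↔
      ∃ b : ℂ[X], (b * X ^ (2 * n + 1) + p * hankelPoly n c).degree < (n : WithBot ℕ) := by
  constructor
  · intro h
    refine ⟨-(p * hankelPoly n c /ₘ X ^ (2 * n + 1)), ?_⟩
    have h1 : -(p * hankelPoly n c /ₘ X ^ (2 * n + 1)) * X ^ (2 * n + 1) + p * hankelPoly n c =
        p * hankelPoly n c %ₘ X ^ (2 * n + 1) := by
      rw [modByMonic_eq_sub_mul_div]
      ring
    have h2 : (p * hankelPoly n c %ₘ X ^ (2 * n + 1)).degree < (2 * n + 1 : ℕ) := by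
      have := degree_modByMonic_lt (p * hankelPoly n c) (monic_X_pow (R := ℂ) (2 * n + 1))
      rwa [degree_X_pow] at this
    rw [h1, degree_lt_iff_coeff_zero]
    intro l hl
    rcases le_or_gt (2 * n + 1) l with hl' | hl'
    · exact (degree_lt_iff_coeff_zero _ _).1 h2 l hl'
    · have h3 := congrFun h ⟨2 * n - l, by omega⟩
      rw [hankel_mulVec_apply n c hp] at h3
      have h4 : 2 * n - (2 * n - l) = l := by omega
      simp only [h4, Pi.zero_apply] at h3
      rw [← h1, coeff_add, coeff_mul_X_pow', if_neg (by omega), zero_add, h3]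
  · rintro ⟨b, hb⟩
    funext i
    have hi : (i : ℕ) ≤ n := Nat.lt_succ_iff.1 i.2
    rw [hankel_mulVec_apply n c hp]
    have h1 := (degree_lt_iff_coeff_zero _ _).1 hb (2 * n - i) (by omega)
    rwa [coeff_add, coeff_mul_X_pow', if_neg (by omega), zero_add] at h1

namespace PadePair

variable {n e : ℕ} {c : ℕ → ℂ}

/-- If a = 0, the remainder b X^(2n+1) is too small in degree unless b = 0, and then the determinant
vanishes. -/
theorem a_ne_zero (P : PadePair n (hankelPoly n c) e) : P.a ≠ 0 := by
  intro h
  have h1 := P.deg_R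
  rw [h, zero_mul, add_zero, mul_comm] at h1
  have h2 := h1.of_X_pow_mul.eq_zero (by push_cast; omega)
  have h3 := P.det
  rw [h, h2, zero_mul, mul_zero, sub_zero] at h3
  exact P.c_ne (C_eq_zero.1 h3.symm)

/-- Cramer's rule in the basis given by the two rows. The coordinate of (p, b) along the second row
is a polynomial whose product with X^(2n+1) has degree at most 2n - e, so it is zero. The same count
bounds the coordinate α along the first row. -/
theorem exists_eq_mul (P : PadePair n (hankelPoly n c) e) {p b : ℂ[X]} (hp : p.natDegree ≤ n)
    (hb : (b * X ^ (2 * n + 1) + p * hankelPoly n c).degree < (n : WithBot ℕ)) :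
    ∃ α : ℂ[X], α.degree < e ∧ p = α * P.a := by
  rw [← degLE_iff_degree_lt] at hb
  have hp' : DegLE p n := fun _ => by exact_mod_cast hp
  have h1 : P.a * b - P.b * p = 0 := by
    refine DegLE.eq_zero (k := (2 * n - e) - (2 * n + 1 : ℕ)) (DegLE.of_X_pow_mul ?_)
      (by push_cast; omega)
    have h2 : X ^ (2 * n + 1) * (P.a * b - P.b * p) =
        P.a * (b * X ^ (2 * n + 1) + p * hankelPoly n c) -
          (P.b * X ^ (2 * n + 1) + P.a * hankelPoly n c) * p := by ring
    rw [h2]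
    exact ((P.deg_a.mul hb).mono (by omega)).sub ((P.deg_R.mul hp').mono (by omega))
  have h3 : DegLE (p * P.b' - P.a' * b) (e - 1) := by
    refine (DegLE.of_X_pow_mul (k := 2 * n + e) (N := 2 * n + 1) ?_).mono (by push_cast; omega)
    have h2 : X ^ (2 * n + 1) * (p * P.b' - P.a' * b) =
        p * (P.b' * X ^ (2 * n + 1) + P.a' * hankelPoly n c) -
          P.a' * (b * X ^ (2 * n + 1) + p * hankelPoly n c) := by ring
    rw [h2]
    exact ((hp'.mul P.deg_R').mono (by omega)).sub ((P.deg_a'.mul hb).mono (by omega))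
  refine ⟨C P.c⁻¹ * (p * P.b' - P.a' * b), ?_, ?_⟩
  · rw [degree_C_mul (inv_ne_zero P.c_ne)]
    exact degLE_iff_degree_lt.1 h3
  · have h4 : C P.c⁻¹ * C P.c = 1 := by rw [← C_mul, inv_mul_cancel₀ P.c_ne, C_1]
    rw [← P.det] at h4
    linear_combination (-p) * h4 + C P.c⁻¹ * P.a' * h1

/-- The kernel of the Hankel matrix consists of the coefficient vectors of the multiples `α a` with
`deg α < e`. -/
theorem finrank_ker_hankel (P : PadePair n (hankelPoly n c) e) :
    Module.finrank ℂ (LinearMap.ker (hankel n c).mulVecLin) = e := by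
  set f : degreeLT ℂ e →ₗ[ℂ] (Fin (n + 1) → ℂ) :=
    LinearMap.pi (fun j : Fin (n + 1) => lcoeff ℂ j) ∘ₗ LinearMap.mulRight ℂ P.a ∘ₗ
      (degreeLT ℂ e).subtype with hf
  have hf_apply : ∀ α, f α = fun j : Fin (n + 1) => ((α : ℂ[X]) * P.a).coeff j := fun α => rfl
  have hα : ∀ α : degreeLT ℂ e, DegLE (α : ℂ[X]) (e - 1) := fun α =>
    degLE_iff_degree_lt.2 (mem_degreeLT.1 α.2)
  have hdeg : ∀ α : degreeLT ℂ e, ((α : ℂ[X]) * P.a).natDegree ≤ n := by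
    intro α
    by_cases h : (α : ℂ[X]) * P.a = 0
    · simp [h]
    · have := ((hα α).mul P.deg_a) h
      omega
  have hinj : Function.Injective f := by
    rw [← LinearMap.ker_eq_bot, LinearMap.ker_eq_bot']
    intro α h
    rw [hf_apply] at h
    have h1 : (α : ℂ[X]) * P.a = 0 := by
      ext l
      rcases le_or_gt (n + 1) l with hl | hl
      · rw [coeff_eq_zero_of_natDegree_lt (by have := hdeg α; omega), coeff_zero]
      · exact congrFun h ⟨l, hl⟩
    rcases mul_eq_zero.1 h1 with h2 | h2
    · exact Subtype.ext h2
    · exact absurd h2 P.a_ne_zero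
  have hrange : LinearMap.range f = LinearMap.ker (hankel n c).mulVecLin := by
    ext v
    rw [LinearMap.mem_range, LinearMap.mem_ker, Matrix.mulVecLin_apply]
    constructor
    · rintro ⟨α, rfl⟩
      rw [hf_apply, hankel_mulVec_eq_zero_iff n c (hdeg α)]
      refine ⟨(α : ℂ[X]) * P.b, degLE_iff_degree_lt.1 ?_⟩
      have h1 : (α : ℂ[X]) * P.b * X ^ (2 * n + 1) + (α : ℂ[X]) * P.a * hankelPoly n c =
          (α : ℂ[X]) * (P.b * X ^ (2 * n + 1) + P.a * hankelPoly n c) := by ring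
      rw [h1]
      exact ((hα α).mul P.deg_R).mono (by omega)
    · intro hv
      set p : ℂ[X] := ∑ j : Fin (n + 1), monomial (j : ℕ) (v j) with hp_def
      have hp : p.natDegree ≤ n := natDegree_sum_le_of_forall_le _ _ fun j _ =>
        (natDegree_monomial_le _).trans (Nat.lt_succ_iff.1 j.2)
      have hpv : (fun j : Fin (n + 1) => p.coeff j) = v := by
        funext j
        rw [hp_def, finsetSum_coeff, Finset.sum_eq_single j]
        · rw [coeff_monomial, if_pos rfl]
        · intro i _ hij
          rw [coeff_monomial, if_neg (fun h => hij (Fin.ext h))]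
        · simp
      rw [← hpv, hankel_mulVec_eq_zero_iff n c hp] at hv
      obtain ⟨b, hb⟩ := hv
      obtain ⟨α, hα', hpα⟩ := P.exists_eq_mul hp hb
      refine ⟨⟨α, mem_degreeLT.2 hα'⟩, ?_⟩
      rw [hf_apply, ← hpv, hpα]
  rw [← hrange, LinearMap.finrank_range_of_inj hinj, (degreeLTEquiv ℂ e).finrank_eq,
    Module.finrank_fin_fun]

theorem corank_hankel (P : PadePair n (hankelPoly n c) e) : corank (hankel n c) = e := by
  have h1 := LinearMap.finrank_range_add_finrank_ker (hankel n c).mulVecLin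
  rw [P.finrank_ker_hankel, Module.finrank_fin_fun] at h1
  unfold corank Matrix.rank
  omega

end PadePair

end Laufer

namespace Laufer

open Polynomial

/-! ### Normal bundles in vertical coordinates -/

/-- The projection of `ℂ³` onto the last two coordinates along a vector `(1, τ₁, τ₂)`. -/
def vertProj (τ : Fin 3 → ℂ) : Matrix (Fin 2) (Fin 3) ℂ :=
  !![-τ 1, 1, 0; -τ 2, 0, 1]

theorem vertProj_mulVec (τ v : Fin 3 → ℂ) :
    (vertProj τ).mulVec v = ![v 1 - v 0 * τ 1, v 2 - v 0 * τ 2] := by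
  ext i
  fin_cases i <;> simp [vertProj, Matrix.mulVec, dotProduct, Fin.sum_univ_three] <;> ring

theorem vertProj_mulVec_surjective (τ : Fin 3 → ℂ) : Function.Surjective (vertProj τ).mulVec := by
  intro w
  refine ⟨![0, w 0, w 1], ?_⟩
  rw [vertProj_mulVec]
  ext i
  fin_cases i <;> simp

theorem vertProj_mulVec_eq_zero_iff {τ : Fin 3 → ℂ} (hτ : τ 0 = 1) (v : Fin 3 → ℂ) :
    (vertProj τ).mulVec v = 0 ↔ ∃ t : ℂ, v = t • τ := by
  rw [vertProj_mulVec]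
  constructor
  · intro h
    have h1 : v 1 - v 0 * τ 1 = 0 := congrFun h 0
    have h2 : v 2 - v 0 * τ 2 = 0 := congrFun h 1
    refine ⟨v 0, ?_⟩
    ext i
    fin_cases i
    · simp [hτ]
    · exact sub_eq_zero.1 h1
    · exact sub_eq_zero.1 h2
  · rintro ⟨t, rfl⟩
    ext i
    fin_cases i <;> simp [hτ]

theorem differentiable_vertProj {τ : ℂ → Fin 3 → ℂ} (hτ : Differentiable ℂ τ) (i : Fin 2)
    (j : Fin 3) : Differentiable ℂ fun z => vertProj (τ z) i j := by
  have h1 : Differentiable ℂ fun z => -τ z 1 := (differentiable_pi.1 hτ 1).neg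
  have h2 : Differentiable ℂ fun z => -τ z 2 := (differentiable_pi.1 hτ 2).neg
  fin_cases i <;> fin_cases j
  exacts [h1, differentiable_const _, differentiable_const _, h2, differentiable_const _,
    differentiable_const _]

/-- The Jacobian T carries the tangent line of τ₀ to that of τ₁ and preserves vertical vectors,
since its top row vanishes off the diagonal. The map induced on the quotients by the tangent lines
is therefore the vertical block. -/
theorem vertProj_mul {T : Matrix (Fin 3) (Fin 3) ℂ} {τ₀ τ₁ : Fin 3 → ℂ} {d : ℂ}
    (h₀ : τ₀ 0 = 1) (h₁ : τ₁ 0 = 1) (h01 : T 0 1 = 0) (h02 : T 0 2 = 0)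
    (h : ∀ i, τ₁ i * d = ∑ j, T i j * τ₀ j) :
    vertProj τ₁ * T = T.submatrix Fin.succ Fin.succ * vertProj τ₀ := by
  simp only [Fin.sum_univ_three, h₀, mul_one] at h
  have e0 := h 0
  have e1 := h 1
  have e2 := h 2
  rw [h₁, h01, h02, one_mul] at e0
  ext i j
  fin_cases i <;> fin_cases j <;>
    simp [vertProj, Matrix.mul_apply, Fin.sum_univ_three, Fin.sum_univ_two, h01, h02]
  · linear_combination τ₁ 1 * e0 - e1
  · linear_combination τ₁ 2 * e0 - e2

/-- The kernel of the projection is the line of τ, because τ has first coordinate 1. A bijective G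
changes neither this kernel nor surjectivity. -/
theorem mul_vertProj_exact {κ : Type} [Fintype κ] [DecidableEq κ] {G : Matrix κ (Fin 2) ℂ}
    (hG : Function.Bijective G.mulVec) {τ : Fin 3 → ℂ} (hτ : τ 0 = 1) :
    Function.Injective (Matrix.of fun i (_ : Unit) => τ i).mulVec ∧
      Function.Exact (Matrix.of fun i (_ : Unit) => τ i).mulVec (G * vertProj τ).mulVec ∧
      Function.Surjective (G * vertProj τ).mulVec := by
  have hcol : ∀ u : Unit → ℂ, (Matrix.of fun i (_ : Unit) => τ i).mulVec u = u () • τ := by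
    intro u
    ext i
    simp [Matrix.mulVec, dotProduct, mul_comm]
  have hcomp : (G * vertProj τ).mulVec = G.mulVec ∘ (vertProj τ).mulVec := by
    funext v
    rw [Function.comp_apply, Matrix.mulVec_mulVec]
  refine ⟨fun u v huv => ?_, fun v => ?_, ?_⟩
  · rw [hcol, hcol] at huv
    have := congrFun huv 0
    simp only [Pi.smul_apply, hτ, smul_eq_mul, mul_one] at this
    exact funext fun _ => this
  · rw [hcomp, Function.comp_apply]
    have h1 : G.mulVec ((vertProj τ).mulVec v) = 0 ↔ (vertProj τ).mulVec v = 0 := by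
      rw [← hG.1.eq_iff, Matrix.mulVec_zero]
    rw [h1, vertProj_mulVec_eq_zero_iff hτ]
    constructor
    · rintro ⟨t, rfl⟩
      exact ⟨fun _ => t, hcol _⟩
    · rintro ⟨u, rfl⟩
      exact ⟨u (), hcol u⟩
  · rw [hcomp]
    exact hG.2.comp (vertProj_mulVec_surjective τ)

theorem deriv_chart_zero {γ : ℂ → Fin 3 → ℂ} (hγ : Differentiable ℂ γ) (h : ∀ z, γ z 0 = z)
    (z : ℂ) : deriv γ z 0 = 1 := by
  have h1 := hasDerivAt_pi.1 (hγ z).hasDerivAt 0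
  rw [funext h] at h1
  exact h1.unique (hasDerivAt_id z)

/-- A bundle is the normal bundle of a section as soon as it is isomorphic to the bundle whose
transition matrix is the vertical block of the Jacobian matrix of the gluing map. -/
theorem Fibration.Section.isNormalBundle_of_vertical {X : Fibration} (s : X.Section) {κ : Type}
    [Fintype κ] [DecidableEq κ] (N : P1Bundle κ) (G₀ G₁ : ℂ → Matrix κ (Fin 2) ℂ)
    (holo₀ : ∀ i j, Differentiable ℂ fun z => G₀ z i j)
    (holo₁ : ∀ i j, Differentiable ℂ fun z => G₁ z i j)
    (bij₀ : ∀ z, Function.Bijective (G₀ z).mulVec) (bij₁ : ∀ z, Function.Bijective (G₁ z).mulVec)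
    (h01 : ∀ z, z ≠ 0 → s.tangentAlong.trans z 0 1 = 0)
    (h02 : ∀ z, z ≠ 0 → s.tangentAlong.trans z 0 2 = 0)
    (compat : ∀ z, z ≠ 0 →
      G₁ z⁻¹ * (s.tangentAlong.trans z).submatrix Fin.succ Fin.succ = N.trans z * G₀ z) :
    s.IsNormalBundle N := by
  have d₀ := deriv_chart_zero s.holo₀ s.base₀
  have d₁ := deriv_chart_zero s.holo₁ s.base₁
  refine ⟨{ map₀ := fun z => G₀ z * vertProj (deriv s.chart₀ z)
            map₁ := fun z => G₁ z * vertProj (deriv s.chart₁ z)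
            holo₀ := fun i j => ?_
            holo₁ := fun i j => ?_
            compat := fun z hz => ?_ }, fun z => ?_, fun z => ?_⟩
  · simp only [Matrix.mul_apply]
    exact Differentiable.fun_sum fun k _ =>
      (holo₀ i k).mul (differentiable_vertProj s.holo₀.deriv k j)
  · simp only [Matrix.mul_apply]
    exact Differentiable.fun_sum fun k _ =>
      (holo₁ i k).mul (differentiable_vertProj s.holo₁.deriv k j)
  · have h1 : vertProj (deriv s.chart₁ z⁻¹) * s.tangentAlong.trans z =
        (s.tangentAlong.trans z).submatrix Fin.succ Fin.succ * vertProj (deriv s.chart₀ z) := by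
      refine vertProj_mul (d := P1Bundle.tangentP1.trans z () ()) (d₀ z) (d₁ z⁻¹) (h01 z hz)
        (h02 z hz) fun i => ?_
      have h2 := congrFun (congrFun (s.differential.compat z hz) i) ()
      rw [Matrix.mul_apply, Matrix.mul_apply, Fintype.sum_unique] at h2
      exact h2
    rw [Matrix.mul_assoc, h1, ← Matrix.mul_assoc, compat z hz, Matrix.mul_assoc]
  · exact mul_vertProj_exact (bij₀ z) (d₀ z)
  · exact mul_vertProj_exact (bij₁ z) (d₁ z)

/-- Reduces Jacobian entries to one-variable derivatives along coordinate lines, which can be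
computed directly from the gluing formula. -/
theorem toMatrix'_fderiv_apply {f : (Fin 3 → ℂ) → (Fin 3 → ℂ)} {p : Fin 3 → ℂ}
    (hf : DifferentiableAt ℂ f p) (i j : Fin 3) :
    LinearMap.toMatrix' (fderiv ℂ f p : (Fin 3 → ℂ) →ₗ[ℂ] (Fin 3 → ℂ)) i j =
      deriv (fun t : ℂ => f (p + t • Pi.single j 1) i) 0 := by
  have h1 : HasDerivAt (fun t : ℂ => p + t • (Pi.single j 1 : Fin 3 → ℂ)) (Pi.single j 1) 0 := by
    simpa using ((hasDerivAt_id (0 : ℂ)).smul_const (Pi.single j 1 : Fin 3 → ℂ)).const_add p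
  have h2 : HasFDerivAt f (fderiv ℂ f p) (p + (0 : ℂ) • Pi.single j 1) := by
    simpa using hf.hasFDerivAt
  have h3 : HasDerivAt (fun t : ℂ => f (p + t • Pi.single j 1) i)
      (fderiv ℂ f p (Pi.single j 1) i) 0 := hasDerivAt_pi.1 (h2.comp_hasDerivAt 0 h1) i
  rw [h3.deriv, LinearMap.toMatrix'_apply]
  rfl

/-! ### The Jacobian of the Laufer gluing along a section -/

section Jacobian

variable {n : ℕ} {B : ℂ → ℂ → ℂ} {hB : IsPotential B} (s : (laufer n B hB).Section) {z : ℂ}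

theorem tangentAlong_trans_apply (hz : z ≠ 0) (i j : Fin 3) :
    s.tangentAlong.trans z i j =
      deriv (fun t : ℂ => (laufer n B hB).glue (s.chart₀ z + t • Pi.single j 1) i) 0 :=
  toMatrix'_fderiv_apply ((laufer n B hB).holo (s.chart₀ z)
    (by change s.chart₀ z 0 ≠ 0; rwa [s.base₀])).differentiableAt i j

theorem tangentAlong_trans_zero_one (hz : z ≠ 0) : s.tangentAlong.trans z 0 1 = 0 := by
  rw [tangentAlong_trans_apply s hz]
  simp [laufer]

theorem tangentAlong_trans_zero_two (hz : z ≠ 0) : s.tangentAlong.trans z 0 2 = 0 := by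
  rw [tangentAlong_trans_apply s hz]
  simp [laufer]

theorem tangentAlong_trans_vertical (hz : z ≠ 0) :
    (s.tangentAlong.trans z).submatrix Fin.succ Fin.succ =
      !![z ^ (-(n : ℤ)), 0;
        z ^ (n + 2) * deriv (deriv (B z)) (s.chart₀ z 1), z ^ (n + 2)] := by
  have hd : HasDerivAt (deriv (B z)) (deriv (deriv (B z)) (s.chart₀ z 1)) (s.chart₀ z 1 + 0) := by
    rw [add_zero]
    exact (hB.deriv_snd.differentiableAt hz _).hasDerivAt
  have hd' : HasDerivAt (fun t => deriv (B z) (s.chart₀ z 1 + t))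
      (deriv (deriv (B z)) (s.chart₀ z 1)) 0 := hd.comp_const_add _ _
  ext i j
  rw [Matrix.submatrix_apply, tangentAlong_trans_apply s hz]
  fin_cases i <;> fin_cases j
  · simp [laufer, s.base₀]
  · simp [laufer]
  · simp [laufer, s.base₀, hd'.deriv]
  · simp [laufer, s.base₀]

end Jacobian

/-! ### The splitting of the normal bundle -/

/-- The reversed polynomial expresses p in the coordinate at infinity. The factor z^l keeps all
exponents natural even when the bound k - l is negative, where p = 0. -/
theorem exists_reflected {p : ℂ[X]} {k l : ℕ} (hp : DegLE p (k - l)) :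
    ∃ q : ℂ[X], ∀ z : ℂ, z ≠ 0 → q.eval z⁻¹ * z ^ k = z ^ l * p.eval z := by
  by_cases h : p = 0
  · exact ⟨0, by simp [h]⟩
  · have hdeg : (X ^ l * p).natDegree ≤ k := by
      have := hp h
      rw [natDegree_mul (pow_ne_zero _ X_ne_zero) h, natDegree_X_pow]
      omega
    refine ⟨(X ^ l * p).reflect k, fun z hz => ?_⟩
    let _ := invertibleOfNonzero hz
    have := eval₂_reflect_mul_pow (RingHom.id ℂ) z k (X ^ l * p) hdeg
    rw [invOf_eq_inv, eval₂_id, eval₂_id] at this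
    rw [this, eval_mul, eval_pow, eval_X]

theorem bijective_mulVec_of_det_ne_zero {G : Matrix (Unit ⊕ Unit) (Fin 2) ℂ}
    (h : G (.inl ()) 0 * G (.inr ()) 1 - G (.inl ()) 1 * G (.inr ()) 0 ≠ 0) :
    Function.Bijective G.mulVec := by
  have hinj : Function.Injective G.mulVecLin := by
    rw [← LinearMap.ker_eq_bot, LinearMap.ker_eq_bot']
    intro v hv
    have h1 := congrFun hv (.inl ())
    have h2 := congrFun hv (.inr ())
    simp only [Matrix.mulVecLin_apply, Matrix.mulVec, dotProduct, Fin.sum_univ_two,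
      Pi.zero_apply] at h1 h2
    have h3 : v 0 = 0 := by
      refine (mul_eq_zero.1 ?_).resolve_left h
      linear_combination G (.inr ()) 1 * h1 - G (.inl ()) 1 * h2
    have h4 : v 1 = 0 := by
      refine (mul_eq_zero.1 ?_).resolve_left h
      linear_combination G (.inl ()) 0 * h2 - G (.inr ()) 0 * h1
    ext i
    fin_cases i
    exacts [h3, h4]
  exact ⟨hinj, (LinearMap.injective_iff_surjective_of_finrank_eq_finrank (by simp)).1 hinj⟩

theorem eval_hankelPoly (n : ℕ) (c : ℕ → ℂ) {z : ℂ} (hz : z ≠ 0) :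
    ∑ j ∈ Finset.range (2 * n + 1), c j * z⁻¹ ^ (j + 1) =
      (hankelPoly n c).eval z / z ^ (2 * n + 1) := by
  unfold hankelPoly
  rw [eval_finsetSum, Finset.sum_div]
  refine Finset.sum_congr rfl fun j hj => ?_
  rw [Finset.mem_range] at hj
  rw [eval_monomial, eq_div_iff (pow_ne_zero _ hz), inv_pow, mul_assoc]
  congr 1
  rw [inv_mul_eq_iff_eq_mul₀ (pow_ne_zero _ hz), ← pow_add]
  congr 1
  omega

/-- Multiply h by a and replace a q / z^(2n+1) by R / z^(2n+1) - b. Then a p - b is entire in z,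
while the terms in R and K become entire in 1/z after the twist by the degree bounds. The row (a',
b') is treated in the same way. -/
theorem exists_vertical_splitting {n e : ℕ} {c : ℕ → ℂ} (P : PadePair n (hankelPoly n c) e)
    {h p K : ℂ → ℂ} (hp : Differentiable ℂ p) (hK : Differentiable ℂ K)
    (hh : ∀ z, z ≠ 0 → h z = p z + ∑ j ∈ Finset.range (2 * n + 1), c j * z⁻¹ ^ (j + 1) +
      z⁻¹ ^ (2 * n + 2) * K z⁻¹) :
    ∃ G₀ G₁ : ℂ → Matrix (Unit ⊕ Unit) (Fin 2) ℂ,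
      (∀ i j, Differentiable ℂ fun z => G₀ z i j) ∧
      (∀ i j, Differentiable ℂ fun z => G₁ z i j) ∧
      (∀ z, Function.Bijective (G₀ z).mulVec) ∧ (∀ z, Function.Bijective (G₁ z).mulVec) ∧
      ∀ z, z ≠ 0 → G₁ z⁻¹ * !![z ^ (-(n : ℤ)), 0; z ^ (n + 2) * h z, z ^ (n + 2)] =
        (P1Bundle.directSum (P1Bundle.lineO (-(e : ℤ) - 1))
          (P1Bundle.lineO ((e : ℤ) - 1))).trans z * G₀ z := by
  set q := hankelPoly n c
  set R := P.b * X ^ (2 * n + 1) + P.a * q with hR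
  set R' := P.b' * X ^ (2 * n + 1) + P.a' * q with hR'
  obtain ⟨A₁, hA₁⟩ := exists_reflected (p := P.a) (k := n + 1) (l := e)
    (by simpa using P.deg_a)
  obtain ⟨R₁, hR₁⟩ := exists_reflected (p := R) (k := n) (l := e) P.deg_R
  obtain ⟨A₂, hA₂⟩ := exists_reflected (p := P.a') (k := n + 1 + e) (l := 0)
    (by simpa using P.deg_a')
  obtain ⟨R₂, hR₂⟩ := exists_reflected (p := R') (k := n + e) (l := 0)
    (by simpa using P.deg_R')
  have hc := P.c_ne
  have hdet : ∀ z, P.a.eval z * P.b'.eval z - P.a'.eval z * P.b.eval z = P.c := by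
    intro z
    have := congrArg (eval z) P.det
    simpa using this
  -- Since a R' - a' R = c X^(2n+1) and the reflection weights in each product add up to 2n + 1 + e,
  -- the reflected determinant is constant away from u = 0, and at u = 0 by continuity.
  have hdet₁ : (fun u => R₁.eval u * A₂.eval u - A₁.eval u * R₂.eval u) = fun _ => -P.c := by
    refine eq_of_forall_ne_zero (by fun_prop) (by fun_prop) fun u hu => ?_
    have hz := inv_ne_zero hu
    have e1 := hA₁ u⁻¹ hz
    have e2 := hR₁ u⁻¹ hz
    have e3 := hA₂ u⁻¹ hz
    have e4 := hR₂ u⁻¹ hz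
    rw [inv_inv] at e1 e2 e3 e4
    rw [hR] at e2
    rw [hR'] at e4
    simp only [eval_add, eval_mul, eval_pow, eval_X] at e2 e4
    have hd := hdet u⁻¹
    generalize u⁻¹ = z at *
    refine mul_right_cancel₀ (pow_ne_zero (2 * n + 1 + e) hz) ?_
    have : (eval u R₁ * eval u A₂ - eval u A₁ * eval u R₂) * z ^ (2 * n + 1 + e) =
        (eval u R₁ * z ^ n) * (eval u A₂ * z ^ (n + 1 + e)) -
          (eval u A₁ * z ^ (n + 1)) * (eval u R₂ * z ^ (n + e)) := by ring
    rw [this, e1, e2, e3, e4, ← hd]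
    ring
  refine ⟨fun z => Matrix.of (Sum.elim
      (fun _ => ![(P.a.eval z * p z - P.b.eval z) / P.c, P.a.eval z / P.c])
      (fun _ => ![(P.b'.eval z - P.a'.eval z * p z) / P.c, -P.a'.eval z / P.c])),
    fun u => Matrix.of (Sum.elim
      (fun _ => ![(-(A₁.eval u * K u) - R₁.eval u) / P.c, A₁.eval u / P.c])
      (fun _ => ![(R₂.eval u + A₂.eval u * K u) / P.c, -A₂.eval u / P.c])), ?_, ?_, ?_, ?_, ?_⟩
  · intro i j
    rcases i with i | i <;> fin_cases j <;> simp <;> fun_prop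
  · intro i j
    rcases i with i | i <;> fin_cases j <;> simp <;> fun_prop
  · intro z
    refine bijective_mulVec_of_det_ne_zero ?_
    simp only [Matrix.of_apply, Sum.elim_inl, Sum.elim_inr, Matrix.cons_val_zero,
      Matrix.cons_val_one]
    have : (P.a.eval z * p z - P.b.eval z) / P.c * (-P.a'.eval z / P.c) -
        P.a.eval z / P.c * ((P.b'.eval z - P.a'.eval z * p z) / P.c) = -P.c⁻¹ := by
      field_simp
      linear_combination -hdet z
    rw [this]
    exact neg_ne_zero.2 (inv_ne_zero hc)
  · intro u
    refine bijective_mulVec_of_det_ne_zero ?_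
    simp only [Matrix.of_apply, Sum.elim_inl, Sum.elim_inr, Matrix.cons_val_zero,
      Matrix.cons_val_one]
    have h1 : R₁.eval u * A₂.eval u - A₁.eval u * R₂.eval u = -P.c := congrFun hdet₁ u
    have : (-(A₁.eval u * K u) - R₁.eval u) / P.c * (-A₂.eval u / P.c) -
        A₁.eval u / P.c * ((R₂.eval u + A₂.eval u * K u) / P.c) = -P.c⁻¹ := by
      field_simp
      linear_combination h1
    rw [this]
    exact neg_ne_zero.2 (inv_ne_zero hc)
  · intro z hz
    have hhz := hh z hz
    rw [eval_hankelPoly n c hz, inv_pow] at hhz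
    have e1 := (eq_div_iff (pow_ne_zero _ hz)).2 (hA₁ z hz)
    have e2 := (eq_div_iff (pow_ne_zero _ hz)).2 (hR₁ z hz)
    have e3 := (eq_div_iff (pow_ne_zero _ hz)).2 (hA₂ z hz)
    have e4 := (eq_div_iff (pow_ne_zero _ hz)).2 (hR₂ z hz)
    rw [hR] at e2
    rw [hR'] at e4
    simp only [eval_add, eval_mul, eval_pow, eval_X] at e2 e4
    have hn : z ^ (-(n : ℤ)) = (z ^ n)⁻¹ := by rw [zpow_neg, zpow_natCast]
    have hl : z ^ (-(-(e : ℤ) - 1)) = z ^ (e + 1) := by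
      rw [← zpow_natCast]
      congr 1
      push_cast
      ring
    have hr : z ^ (-((e : ℤ) - 1)) = z / z ^ e := by
      rw [neg_sub, zpow_sub₀ hz, zpow_one, zpow_natCast]
    ext i j
    rcases i with i | i <;> fin_cases j <;>
      simp [Matrix.mul_apply, Fin.sum_univ_two, P1Bundle.directSum, P1Bundle.lineO, -zpow_neg,
        -neg_sub, hl, hr, hn, e1, e2, e3, e4, hhz] <;>
      field_simp <;> ring

end Laufer
-- The section, its uniqueness and its normal bundle
theorem mainTheorem1 (n : ℕ) (B : ℂ → ℂ → ℂ) (hB : Laufer.IsPotential B)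
    (x : Fin (n + 1) → ℂ)
    (hx : ∀ i, Laufer.pderiv i (Laufer.superpotential n B) x = 0)
    (r : ℕ) (hr : r = Laufer.corank (Laufer.hessian (Laufer.superpotential n B) x)) :
    ∃ s : (Laufer.laufer n B hB).Section,
      (∀ z, s.chart₀ z 1 = ∑ i, x i * z ^ (i : ℕ)) ∧
      (∀ t : (Laufer.laufer n B hB).Section,
        (∀ z, t.chart₀ z 1 = ∑ i, x i * z ^ (i : ℕ)) → t = s) ∧
      s.IsNormalBundle
        (Laufer.P1Bundle.directSum
          (Laufer.P1Bundle.lineO (-(r : ℤ) - 1)) (Laufer.P1Bundle.lineO ((r : ℤ) - 1))) := by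
  obtain ⟨s, hs⟩ := Laufer.exists_section hB x hx
  refine ⟨s, hs, fun t ht => Laufer.section_unique s t fun z => (ht z).trans (hs z).symm, ?_⟩
  have hω : Differentiable ℂ fun z : ℂ => ∑ i, x i * z ^ (i : ℕ) := by fun_prop
  -- The 2n + 1 coefficients singled out are those indexed by i + j with i, j ≤ n, that is, the
  -- entries of the Hessian.
  obtain ⟨p, K, hp, hK, hh⟩ := Laufer.exists_laurent_expansion
    (hB.deriv_snd.deriv_snd.differentiableOn_comp hω) (2 * n + 1)
  set c : ℕ → ℂ := fun j => (2 * Real.pi * Complex.I)⁻¹ *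
    ∮ z in C(0, 1), z ^ j * deriv (deriv (B z)) (∑ i, x i * z ^ (i : ℕ)) with hc
  obtain ⟨e, ⟨P⟩⟩ := Laufer.exists_padePair n (Laufer.hankelPoly n c)
    (Laufer.natDegree_hankelPoly_le n c)
  have hhess : Laufer.hessian (Laufer.superpotential n B) x = Laufer.hankel n c := by
    ext i j
    exact Laufer.hessian_superpotential_apply hB x i j
  have hre : r = e := by rw [hr, hhess, P.corank_hankel]
  subst hre
  obtain ⟨G₀, G₁, holo₀, holo₁, bij₀, bij₁, compat⟩ :=
    Laufer.exists_vertical_splitting P hp hK hh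
  refine s.isNormalBundle_of_vertical _ G₀ G₁ holo₀ holo₁ bij₀ bij₁
    (fun z hz => Laufer.tangentAlong_trans_zero_one s hz)
    (fun z hz => Laufer.tangentAlong_trans_zero_two s hz) fun z hz => ?_
  rw [Laufer.tangentAlong_trans_vertical s hz, hs]
  exact compat z hz
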